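/- **Setting.** Let $d\ge 1$ and let $\eta\in\mathbb R^d$ have nonzero entries ordered so that $|\eta_1|\ge\dots\ge|\eta_d|>0$; let $\sigma>0$ and let $s\in\{1,\dots,d\}$ be an integer. We observe $y_j=\theta_j+\sigma\xi_j$, $j=1,\dots,d$, and estimate $L(\theta)=\sum_{j=1}^d\eta_j\theta_j$, where $\theta\in\Theta_s=\{\theta\in\mathbb R^d:\ \#\{j:\theta_j\ne0\}\le s\}$. For $\alpha,\tau>0$ let $\mathcal G_{\alpha,\tau}$ be the class of probability distributions $P$ on $\mathbb R$ such that $W\sim P$ is symmetric around $0$, $\mathbb E W^2=1$, and $\mathbb P(|W|\ge t)\le 2\exp\{-2(t/\tau)^\alpha\}$ for all $t\ge0$. Let $\mathcal G_{\alpha,\tau}^\otimes=\{\otimes_{j=1}^d P_j:\ P_j\in\mathcal G_{\alpha,\tau}\}$, and let $\mathbb E_{\theta,\mathcal P_\xi}$ be the expectation when the signal is $\theta$ and $(\xi_1,\dots,\xi_d)$ has the distribution $\mathcal P_\xi\in\mathcal G_{\alpha,\tau}^\otimes$. **Theorem.** Let $\alpha>0$. (0) For all $d$, $\eta$, $s$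 as above, the equation $$\frac{\sum_{j=1}^d|\eta_j|\exp(-\beta/|\eta_j|^\alpha)}{\sqrt{\sum_{j=1}^d\eta_j^2\exp(-\beta/|\eta_j|^\alpha)}}=\frac s2$$ has a unique solution $\beta=\beta(s;\eta,\alpha)\in\mathbb R$. Put $\lambda_o=\max(\beta,0)^{1/\alpha}$, $\ \nu=\sqrt{\sum_{j=1}^d\eta_j^2\exp(-(\lambda_o/|\eta_j|)^\alpha)}$, $\ \Phi_o(s;\eta)=(\lambda_o s+\nu)^2$, and $j_1(s)=\max\{j\in\{1,\dots,d\}:|\eta_j|\ge\lambda_o\}$ (with $j_1(s)=0$ if there is no such $j$). (1) (Lower bound.) There are constants $c,\tau_\alpha>0$, depending only on $\alpha$, such that for all $\tau\ge\tau_\alpha$ and all $d,\eta,s,\sigma$ as above, $$\inf_{\hat T}\ \sup_{\theta\in\Theta_s}\ \sup_{\mathcal P_\xi\in\mathcal G_{\alpha,\tau}^\otimes}\mathbb E_{\theta,\mathcal P_\xi}\bigl(\hat T-L(\theta)\bigr)^2\ \ge\ c\,\sigma^2\,\Phi_o(s;\eta),$$ where the infimum is over all estimators, i.e. all measurable functions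 $\hat T=\hat T(y_1,\dots,y_d)$. (2) (Upper bound.) For every $\tau>0$ there is a constant $C>0$, depending only on $\alpha$ and $\tau$, such that for all $d,\eta,s,\sigma$ as above the (measurable) estimator $$\hat L_s=\sum_{j\le j_1(s)}\eta_jy_j+\sum_{j>j_1(s)}\eta_jy_j\,\mathbf 1\{|\eta_jy_j|>\sigma\tau\lambda_o\}$$ satisfies $$\sup_{\theta\in\Theta_s}\ \sup_{\mathcal P_\xi\in\mathcal G_{\alpha,\tau}^\otimes}\mathbb E_{\theta,\mathcal P_\xi}\bigl(\hat L_s-L(\theta)\bigr)^2\ \le\ C\,\sigma^2\,\Phi_o(s;\eta).$$ -/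

import Mathlib

open MeasureTheory
open scoped ENNReal

noncomputable section

namespace SparseFunctional

/-- The class of symmetric laws on the line with unit second moment and
sub-Weibull tails. (The Bochner integral being `1` forces integrability of the square.) -/
structure SymmSubWeibull (α τ : ℝ) (P : Measure ℝ) : Prop where
  isProb : IsProbabilityMeasure P
  symm : P.map (fun x : ℝ => -x) = P
  second_moment : ∫ x, x ^ 2 ∂P = 1
  tail : ∀ t : ℝ, 0 ≤ t → P.real {x : ℝ | t ≤ |x|} ≤ 2 * Real.exp (-2 * (t / τ) ^ α)

/-- The families of marginals `(P_1, …, P_d)` of the product noise distributions in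
the product class. -/
def noiseClass (d : ℕ) (α τ : ℝ) : Set (Fin d → Measure ℝ) :=
  {P | ∀ j, SymmSubWeibull α τ (P j)}

/-- The number of nonzero coordinates. -/
def zeroNorm {d : ℕ} (θ : Fin d → ℝ) : ℕ := {j : Fin d | θ j ≠ 0}.ncard

/-- The set of `s`-sparse vectors. -/
def sparseSet (d s : ℕ) : Set (Fin d → ℝ) := {θ | zeroNorm θ ≤ s}

/-- The linear functional `θ ↦ ∑ j, η j * θ j`. -/
def linFun {d : ℕ} (η θ : Fin d → ℝ) : ℝ := ∑ j, η j * θ j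

/-- The law of `y = θ + σ ξ`, where `ξ` has independent coordinates `ξ j ∼ P j`. -/
def obsLaw {d : ℕ} (σ : ℝ) (θ : Fin d → ℝ) (P : Fin d → Measure ℝ) : Measure (Fin d → ℝ) :=
  (Measure.pi P).map (fun ξ j => θ j + σ * ξ j)

/-- The mean squared error of `T` as an estimator of the linear functional,
with values in `[0, ∞]`. -/
def mse {d : ℕ} (σ : ℝ) (η : Fin d → ℝ) (T : (Fin d → ℝ) → ℝ)
    (θ : Fin d → ℝ) (P : Fin d → Measure ℝ) : ℝ≥0∞ :=
  ∫⁻ y, ENNReal.ofReal ((T y - linFun η θ) ^ 2) ∂(obsLaw σ θ P)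

/-- The maximal mean squared error of `T` over `s`-sparse signals and over the noise class. -/
def maxRisk {d : ℕ} (α τ σ : ℝ) (η : Fin d → ℝ) (s : ℕ) (T : (Fin d → ℝ) → ℝ) : ℝ≥0∞ :=
  ⨆ θ ∈ sparseSet d s, ⨆ P ∈ noiseClass d α τ, mse σ η T θ P

/-- The minimax risk: the infimum of the maximal risk over all (measurable) estimators. -/
def minimaxRisk {d : ℕ} (α τ σ : ℝ) (η : Fin d → ℝ) (s : ℕ) : ℝ≥0∞ :=
  ⨅ (T : (Fin d → ℝ) → ℝ) (_ : Measurable T), maxRisk α τ σ η s T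

/-- `β` solves the equation that calibrates the threshold. -/
def BetaEquation {d : ℕ} (α : ℝ) (η : Fin d → ℝ) (s : ℕ) (β : ℝ) : Prop :=
  (∑ j, |η j| * Real.exp (-β / |η j| ^ α)) /
      √(∑ j, (η j) ^ 2 * Real.exp (-β / |η j| ^ α)) = (s : ℝ) / 2

open scoped Classical in
/-- The solution `β` of the calibration equation (with the irrelevant value `0` if there
is none). -/
def beta {d : ℕ} (α : ℝ) (η : Fin d → ℝ) (s : ℕ) : ℝ :=
  if h : ∃ β, BetaEquation α η s β then h.choose else 0

/-- `λ_o = (β₊)^(1/α)`. -/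
def lambdaO {d : ℕ} (α : ℝ) (η : Fin d → ℝ) (s : ℕ) : ℝ :=
  (max (beta α η s) 0) ^ (1 / α)

/-- `ν = √(∑ j, η_j² exp(-(λ_o / |η_j|)^α))`. -/
def nu {d : ℕ} (α : ℝ) (η : Fin d → ℝ) (s : ℕ) : ℝ :=
  √(∑ j, (η j) ^ 2 * Real.exp (-(lambdaO α η s / |η j|) ^ α))

/-- The rate `Φ_o(s; η) = (λ_o s + ν)²`. -/
def phiO {d : ℕ} (α : ℝ) (η : Fin d → ℝ) (s : ℕ) : ℝ :=
  (lambdaO α η s * s + nu α η s) ^ 2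

open scoped Classical in
/-- The largest index `j ∈ {1, …, d}` (counted from one) with `|η_j| ≥ λ_o`, and `0` if
there is none. -/
def j1 {d : ℕ} (α : ℝ) (η : Fin d → ℝ) (s : ℕ) : ℕ :=
  (Finset.univ.filter (fun j : Fin d => lambdaO α η s ≤ |η j|)).sup (fun j => (j : ℕ) + 1)

open scoped Classical in
/-- The estimator: plug-in for the indices `j ≤ j_1(s)` (counted from one) and
hard thresholding for the others. -/
def estimator {d : ℕ} (α τ σ : ℝ) (η : Fin d → ℝ) (s : ℕ) (y : Fin d → ℝ) : ℝ :=
  ∑ j : Fin d,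
    if (j : ℕ) + 1 ≤ j1 α η s then η j * y j
    else if σ * τ * lambdaO α η s < |η j * y j| then η j * y j else 0

end SparseFunctional

end

/-! Write `A(β) = ∑ |η_j| exp(-β/|η_j|^α)`, `B(β) = ∑ η_j² exp(-β/|η_j|^α)`, `l = λ_o` and `e_j =
exp(-(l/|η_j|)^α)`.

Calibration. The squared ratio `A²/B = A · (A/B)` is strictly decreasing: `A` decreases, and `A/B`
does not increase, by Chebyshev's sum inequality. Exponential bounds on both sides show that the
value `s/2` is reached.

Upper bound. Outside the support of `θ` and in the plug-in range, the error is an odd function of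
symmetric noise, so it is centered and its variances add up. A truncated second moment is at most a
constant times `e_j`, hence the total is of order `σ²ν²`. Each of the at most `s` remaining
coordinates costs at most `σ l (|ξ_j| + τ)`, which gives `σ²l²s²` (`estimator_error_sq_le`).

Lower bound. The noise has density proportional to `exp(-c|x|^α)`, with `c` chosen to give unit
variance. The signal `0` is tested against a product prior: `θ_j = σ sign(η_j) κ (l/|η_j| + 1)` with
probability `p_j = |η_j| e_j / ν`, and `0` otherwise. A translate has second likelihood moment at
most `K / e_j`, so the weighted sum `∑ p_j² K / e_j` equals `K`: the hypotheses stay close. The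
prior mean of `L` is `σκ(ls/2 + ν)` by calibration, and `∑ p_j ≤ s/2` makes the restriction to
sparse signals cost only a factor 2 (`half_le_sum_bernWeight`, `le_maxRisk_of_prior`). -/

open MeasureTheory
open scoped ENNReal

noncomputable section

namespace SparseFunctional

/-! ### The calibration equation -/

section Calibration

variable {d : ℕ} {α : ℝ} {η : Fin d → ℝ}

/-- The weighted sum `∑ |η_j| exp(-β / |η_j|^α)`. -/
def absSum (α : ℝ) (η : Fin d → ℝ) (β : ℝ) : ℝ :=
  ∑ j, |η j| * Real.exp (-β / |η j| ^ α)

/-- The weighted sum `∑ η_j² exp(-β / |η_j|^α)`. -/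
def sqSum (α : ℝ) (η : Fin d → ℝ) (β : ℝ) : ℝ :=
  ∑ j, (η j) ^ 2 * Real.exp (-β / |η j| ^ α)

lemma absSum_pos (hd : 0 < d) (hη : ∀ j, η j ≠ 0) (β : ℝ) : 0 < absSum α η β := by
  have : Nonempty (Fin d) := ⟨⟨0, hd⟩⟩
  refine Finset.sum_pos (fun j _ => ?_) Finset.univ_nonempty
  have := abs_pos.2 (hη j)
  positivity

lemma sqSum_pos (hd : 0 < d) (hη : ∀ j, η j ≠ 0) (β : ℝ) : 0 < sqSum α η β := by
  have : Nonempty (Fin d) := ⟨⟨0, hd⟩⟩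
  refine Finset.sum_pos (fun j _ => ?_) Finset.univ_nonempty
  have := hη j
  positivity

lemma continuous_absSum : Continuous (absSum α η) := by
  unfold absSum; fun_prop

lemma continuous_sqSum : Continuous (sqSum α η) := by
  unfold sqSum; fun_prop

/-- Chebyshev's sum inequality for two similarly ordered functions `a` and `w`, with the
weights `p`. -/
lemma sum_mul_sum_le_of_monovary {ι : Type*} [Fintype ι] (p a w : ι → ℝ) (hp : ∀ i, 0 ≤ p i)
    (h : ∀ i j, 0 ≤ (w i - w j) * (a i - a j)) :
    (∑ i, p i * w i) * (∑ i, p i * a i) ≤ (∑ i, p i) * (∑ i, p i * a i * w i) := by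
  -- Expanding this double sum gives twice the difference of the two sides.
  have key : 0 ≤ ∑ i, ∑ j, p i * p j * ((w i - w j) * (a i - a j)) :=
    Finset.sum_nonneg fun i _ => Finset.sum_nonneg fun j _ =>
      mul_nonneg (mul_nonneg (hp i) (hp j)) (h i j)
  have e1 : ∑ i, ∑ j, p i * p j * ((w i - w j) * (a i - a j)) =
      ∑ i, ∑ j, (p i * (p j * a j * w j) + p j * (p i * a i * w i)
        - (p i * w i) * (p j * a j) - (p j * w j) * (p i * a i)) :=
    Finset.sum_congr rfl fun i _ => Finset.sum_congr rfl fun j _ => by ring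
  rw [e1] at key
  simp only [Finset.sum_sub_distrib, Finset.sum_add_distrib] at key
  rw [Finset.sum_comm (f := fun i j => p j * (p i * a i * w i)),
    Finset.sum_comm (f := fun i j => (p j * w j) * (p i * a i))] at key
  simp only [← Finset.sum_mul_sum] at key
  linarith

/-- Passing from `β` to `β'` multiplies each term by `exp(-(β'-β)/|η_j|^α)`, which is monotone in
`|η_j|`. This favours large `|η_j|`, so `B` loses relatively no more than `A`, while `A` itself
strictly decreases. -/
lemma absSum_div_sqrt_strictAnti (hα : 0 < α) (hd : 0 < d) (hη : ∀ j, η j ≠ 0) :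
    StrictAnti (fun β => absSum α η β / √(sqSum α η β)) := by
  intro β β' hβ
  have : Nonempty (Fin d) := ⟨⟨0, hd⟩⟩
  have ha : ∀ j, 0 < |η j| := fun j => abs_pos.2 (hη j)
  have hA := absSum_pos (α := α) hd hη β
  have hA' := absSum_pos (α := α) hd hη β'
  have hB := sqSum_pos (α := α) hd hη β
  have hB' := sqSum_pos (α := α) hd hη β'
  have hlt : absSum α η β' < absSum α η β := by
    refine Finset.sum_lt_sum_of_nonempty Finset.univ_nonempty fun j _ => ?_
    have := Real.rpow_pos_of_pos (ha j) α
    have := ha j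
    gcongr
  have hch : absSum α η β' * sqSum α η β ≤ absSum α η β * sqSum α η β' := by
    have := sum_mul_sum_le_of_monovary (fun j => |η j| * Real.exp (-β / |η j| ^ α))
      (fun j => |η j|) (fun j => Real.exp (-(β' - β) / |η j| ^ α))
      (fun j => by positivity) (fun i j => ?_)
    · convert this using 2
      · refine Finset.sum_congr rfl fun j _ => ?_
        rw [mul_assoc, ← Real.exp_add]
        ring_nf
      · refine Finset.sum_congr rfl fun j _ => ?_
        rw [← sq_abs]; ring
      · rfl
      · refine Finset.sum_congr rfl fun j _ => ?_
        rw [← sq_abs, show |η j| * Real.exp (-β / |η j| ^ α) * |η j| *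
          Real.exp (-(β' - β) / |η j| ^ α) = |η j| ^ 2 * (Real.exp (-β / |η j| ^ α) *
          Real.exp (-(β' - β) / |η j| ^ α)) by ring, ← Real.exp_add]
        ring_nf
    · have mono : ∀ i j, |η i| ≤ |η j| → Real.exp (-(β' - β) / |η i| ^ α) ≤
          Real.exp (-(β' - β) / |η j| ^ α) := fun i j hij => by
        have h1 := Real.rpow_pos_of_pos (ha i) α
        have h2 := Real.rpow_le_rpow (ha i).le hij hα.le
        rw [Real.exp_le_exp, neg_div, neg_div, neg_le_neg_iff]
        have : 0 ≤ β' - β := by linarith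
        gcongr
      rcases le_total |η i| |η j| with hij | hij
      · exact mul_nonneg_of_nonpos_of_nonpos (sub_nonpos.2 (mono _ _ hij)) (sub_nonpos.2 hij)
      · exact mul_nonneg (sub_nonneg.2 (mono _ _ hij)) (sub_nonneg.2 hij)
  show absSum α η β' / √(sqSum α η β') < absSum α η β / √(sqSum α η β)
  rw [div_lt_div_iff₀ (by positivity) (by positivity)]
  refine lt_of_pow_lt_pow_left₀ 2 (by positivity) ?_
  rw [mul_pow, mul_pow, Real.sq_sqrt hB.le, Real.sq_sqrt hB'.le]
  calc absSum α η β' ^ 2 * sqSum α η β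
      = absSum α η β' * (absSum α η β' * sqSum α η β) := by ring
    _ ≤ absSum α η β' * (absSum α η β * sqSum α η β') := by gcongr
    _ < absSum α η β * (absSum α η β * sqSum α η β') := by gcongr
    _ = absSum α η β ^ 2 * sqSum α η β' := by ring

lemma continuous_absSum_div_sqrt (hd : 0 < d) (hη : ∀ j, η j ≠ 0) :
    Continuous (fun β => absSum α η β / √(sqSum α η β)) :=
  continuous_absSum.div continuous_sqSum.sqrt
    fun β => (Real.sqrt_pos.2 (sqSum_pos hd hη β)).ne'

/-- Cauchy–Schwarz, with one of the two exponential factors bounded by its value at `M`. With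
`le_absSum_sq`, which uses that a sum of squares is at most the square of the sum, it controls the
ratio at both ends. -/
lemma absSum_sq_le (hα : 0 < α) (hη : ∀ j, η j ≠ 0) {M : ℝ}
    (hM : ∀ j, |η j| ≤ M) {β : ℝ} (hβ : 0 ≤ β) :
    (absSum α η β) ^ 2 ≤ d * Real.exp (-β / M ^ α) * sqSum α η β := by
  have h1 : (absSum α η β) ^ 2 ≤
      d * ∑ j, (|η j| * Real.exp (-β / |η j| ^ α)) ^ 2 := by
    have := sq_sum_le_card_mul_sum_sq (s := Finset.univ)
      (f := fun j => |η j| * Real.exp (-β / |η j| ^ α))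
    simpa [absSum] using this
  refine h1.trans ?_
  rw [mul_assoc, sqSum, Finset.mul_sum (a := Real.exp _)]
  refine mul_le_mul_of_nonneg_left (Finset.sum_le_sum fun j _ => ?_) (Nat.cast_nonneg d)
  have ha : 0 < |η j| := abs_pos.2 (hη j)
  have h2 : Real.exp (-β / |η j| ^ α) ≤ Real.exp (-β / M ^ α) := by
    have h1 := Real.rpow_pos_of_pos ha α
    have h2 := Real.rpow_le_rpow ha.le (hM j) hα.le
    rw [Real.exp_le_exp, neg_div, neg_div, neg_le_neg_iff]
    gcongr
  rw [mul_pow, sq_abs, sq (Real.exp _)]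
  have := Real.exp_pos (-β / |η j| ^ α)
  nlinarith [mul_le_mul_of_nonneg_left h2 (mul_nonneg (sq_nonneg (η j)) this.le)]

lemma le_absSum_sq (hα : 0 < α) (hη : ∀ j, η j ≠ 0) {M : ℝ}
    (hM : ∀ j, |η j| ≤ M) {β : ℝ} (hβ : β ≤ 0) :
    Real.exp (-β / M ^ α) * sqSum α η β ≤ (absSum α η β) ^ 2 := by
  have h1 : ∑ j, (|η j| * Real.exp (-β / |η j| ^ α)) ^ 2 ≤ (absSum α η β) ^ 2 :=
    Finset.sum_sq_le_sq_sum_of_nonneg fun j _ => by positivity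
  refine le_trans ?_ h1
  rw [sqSum, Finset.mul_sum]
  refine Finset.sum_le_sum fun j _ => ?_
  have ha : 0 < |η j| := abs_pos.2 (hη j)
  have h2 : Real.exp (-β / M ^ α) ≤ Real.exp (-β / |η j| ^ α) := by
    have h1 := Real.rpow_pos_of_pos ha α
    have h2 := Real.rpow_le_rpow ha.le (hM j) hα.le
    rw [Real.exp_le_exp]
    have : 0 ≤ -β := by linarith
    gcongr
  rw [mul_pow, sq_abs, sq (Real.exp _)]
  have := Real.exp_pos (-β / |η j| ^ α)
  nlinarith [mul_le_mul_of_nonneg_left h2 (mul_nonneg (sq_nonneg (η j)) this.le)]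

theorem existsUnique_betaEquation (hα : 0 < α) (hη : ∀ j, η j ≠ 0) {s : ℕ}
    (hs : 1 ≤ s) (hsd : s ≤ d) : ∃! β : ℝ, BetaEquation α η s β := by
  have hd : 0 < d := by omega
  have hd' : (0 : ℝ) < d := by exact_mod_cast hd
  have hs' : (1 : ℝ) ≤ s := by exact_mod_cast hs
  set f := fun β => absSum α η β / √(sqSum α η β) with hf
  have hM : ∀ j, |η j| ≤ ∑ i, |η i| := fun j =>
    Finset.single_le_sum (f := fun i => |η i|) (fun i _ => abs_nonneg _) (Finset.mem_univ j)
  have hM0 : 0 < ∑ i, |η i| := lt_of_lt_of_le (abs_pos.2 (hη ⟨0, hd⟩)) (hM ⟨0, hd⟩)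
  have hMα := Real.rpow_pos_of_pos hM0 α
  have hanti := absSum_div_sqrt_strictAnti hα hd hη
  have hfsq : ∀ β, 0 ≤ f β ∧ (f β) ^ 2 * sqSum α η β = (absSum α η β) ^ 2 := fun β => by
    have h1 := sqSum_pos (α := α) hd hη β
    have h2 := absSum_pos (α := α) hd hη β
    refine ⟨by positivity, ?_⟩
    rw [hf]; dsimp only
    rw [div_pow, Real.sq_sqrt h1.le]
    field_simp
  have lower : ∃ β, f β ≤ s / 2 := by
    -- Here the squared ratio is at most `d exp(-4d) ≤ 1/4 ≤ (s/2)²`.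
    refine ⟨(∑ i, |η i|) ^ α * (4 * d), ?_⟩
    obtain ⟨h0, h1⟩ := hfsq ((∑ i, |η i|) ^ α * (4 * d))
    have h2 := absSum_sq_le hα hη hM (β := (∑ i, |η i|) ^ α * (4 * d)) (by positivity)
    rw [← h1] at h2
    have h3 := le_of_mul_le_mul_right h2 (sqSum_pos hd hη _)
    rw [neg_div, mul_div_cancel_left₀ _ hMα.ne', Real.exp_neg] at h3
    have h4 := Real.add_one_le_exp (4 * (d : ℝ))
    have h5 : (d : ℝ) * (Real.exp (4 * d))⁻¹ ≤ 1 / 4 := by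
      rw [← div_eq_mul_inv, div_le_iff₀ (Real.exp_pos _)]
      linarith
    nlinarith
  have upper : ∃ β, s / 2 ≤ f β := by
    -- Here the squared ratio is at least `exp(s²) ≥ s² + 1`.
    refine ⟨-((∑ i, |η i|) ^ α * (s ^ 2)), ?_⟩
    obtain ⟨h0, h1⟩ := hfsq (-((∑ i, |η i|) ^ α * (s ^ 2)))
    have h2 := le_absSum_sq hα hη hM (β := -((∑ i, |η i|) ^ α * (s ^ 2)))
      (by rw [neg_nonpos]; positivity)
    rw [← h1] at h2
    have h3 := le_of_mul_le_mul_right h2 (sqSum_pos hd hη _)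
    rw [neg_neg, mul_div_cancel_left₀ _ hMα.ne'] at h3
    have h4 := Real.add_one_le_exp ((s : ℝ) ^ 2)
    nlinarith
  obtain ⟨b1, hb1⟩ := lower
  obtain ⟨b2, hb2⟩ := upper
  obtain ⟨β, hβ⟩ := mem_range_of_exists_le_of_exists_ge
    (continuous_absSum_div_sqrt (α := α) hd hη) ⟨b1, hb1⟩ ⟨b2, hb2⟩
  exact ⟨β, hβ, fun β' hβ' => hanti.injective (hβ'.trans hβ.symm)⟩

lemma betaEquation_beta (hα : 0 < α) (hη : ∀ j, η j ≠ 0) {s : ℕ}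
    (hs : 1 ≤ s) (hsd : s ≤ d) : BetaEquation α η s (beta α η s) := by
  have h := (existsUnique_betaEquation hα hη hs hsd).exists
  rw [beta, dif_pos h]
  exact h.choose_spec

lemma lambdaO_nonneg (s : ℕ) : 0 ≤ lambdaO α η s := by
  unfold lambdaO; positivity

lemma exp_neg_lambdaO_div (hα : 0 < α) (s : ℕ) (x : ℝ) :
    Real.exp (-(lambdaO α η s / |x|) ^ α) =
      Real.exp (-(max (beta α η s) 0) / |x| ^ α) := by
  rw [Real.div_rpow (lambdaO_nonneg s) (abs_nonneg x), lambdaO, ← Real.rpow_mul (by positivity),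
    one_div_mul_cancel hα.ne', Real.rpow_one, neg_div]

lemma nu_eq (hα : 0 < α) (s : ℕ) : nu α η s = √(sqSum α η (max (beta α η s) 0)) := by
  unfold nu sqSum
  simp_rw [exp_neg_lambdaO_div hα]

lemma nu_pos (hα : 0 < α) (hd : 0 < d) (hη : ∀ j, η j ≠ 0) (s : ℕ) : 0 < nu α η s := by
  rw [nu_eq hα]
  exact Real.sqrt_pos.2 (sqSum_pos hd hη _)

lemma nu_sq (s : ℕ) :
    nu α η s ^ 2 = ∑ j, (η j) ^ 2 * Real.exp (-(lambdaO α η s / |η j|) ^ α) :=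
  Real.sq_sqrt (Finset.sum_nonneg fun j _ => by positivity)

/-- The calibration equation for the positive part of `β`: an inequality in general. -/
lemma sum_abs_mul_exp_le (hα : 0 < α) (hη : ∀ j, η j ≠ 0) {s : ℕ}
    (hs : 1 ≤ s) (hsd : s ≤ d) :
    ∑ j, |η j| * Real.exp (-(lambdaO α η s / |η j|) ^ α) ≤ s / 2 * nu α η s := by
  have hd : 0 < d := by omega
  have hb : absSum α η (beta α η s) / √(sqSum α η (beta α η s)) = s / 2 :=
    betaEquation_beta hα hη hs hsd
  have h := (absSum_div_sqrt_strictAnti hα hd hη).antitone (le_max_left (beta α η s) 0)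
  simp only [hb] at h
  rw [div_le_iff₀ (Real.sqrt_pos.2 (sqSum_pos hd hη _)), ← nu_eq hα] at h
  simp_rw [exp_neg_lambdaO_div hα]
  exact h

/-- The calibration equation, multiplied by `λ_o`. -/
lemma lambdaO_mul_sum_abs_mul_exp (hα : 0 < α) (hη : ∀ j, η j ≠ 0) {s : ℕ}
    (hs : 1 ≤ s) (hsd : s ≤ d) :
    lambdaO α η s * ∑ j, |η j| * Real.exp (-(lambdaO α η s / |η j|) ^ α) =
      lambdaO α η s * (s / 2 * nu α η s) := by
  have hd : 0 < d := by omega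
  have hb : absSum α η (beta α η s) / √(sqSum α η (beta α η s)) = s / 2 :=
    betaEquation_beta hα hη hs hsd
  -- For `β ≤ 0` the calibration may fail at `max β 0`, but then `λ_o = 0` and both sides vanish.
  rcases le_or_gt (beta α η s) 0 with h | h
  · have : lambdaO α η s = 0 := by
      rw [lambdaO, max_eq_right h, Real.zero_rpow (by positivity)]
    simp [this]
  · rw [div_eq_iff (Real.sqrt_pos.2 (sqSum_pos hd hη _)).ne'] at hb
    simp_rw [exp_neg_lambdaO_div hα, nu_eq hα, max_eq_left h.le]
    rw [← hb, absSum]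

end Calibration

/-! ### Cauchy–Schwarz and moments of the noise class -/

/-- The Cauchy–Schwarz inequality for the Lebesgue integral. -/
lemma sq_lintegral_mul_le {Ω : Type*} [MeasurableSpace Ω] (μ : Measure Ω) {f g : Ω → ℝ≥0∞}
    (hf : AEMeasurable f μ) (hg : AEMeasurable g μ) :
    (∫⁻ x, f x * g x ∂μ) ^ 2 ≤ (∫⁻ x, f x ^ 2 ∂μ) * ∫⁻ x, g x ^ 2 ∂μ := by
  have h := ENNReal.lintegral_mul_le_Lp_mul_Lq μ Real.HolderConjugate.two_two hf hg
  have h2 := pow_le_pow_left₀ zero_le h 2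
  refine h2.trans_eq ?_
  rw [mul_pow, ← ENNReal.rpow_natCast, ← ENNReal.rpow_natCast, ← ENNReal.rpow_mul,
    ← ENNReal.rpow_mul]
  norm_num

section Noise

variable {α τ : ℝ} {P : Measure ℝ}

lemma SymmSubWeibull.integrable_sq (hP : SymmSubWeibull α τ P) :
    Integrable (fun x : ℝ => x ^ 2) P := by
  by_contra h
  have := hP.second_moment
  rw [integral_undef h] at this
  exact zero_ne_one this

lemma SymmSubWeibull.integral_eq_zero_of_odd (hP : SymmSubWeibull α τ P) {φ : ℝ → ℝ}
    (hφ : ∀ x, φ (-x) = -φ x) : ∫ x, φ x ∂P = 0 := by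
  have h : ∫ x, φ x ∂P = ∫ x, φ (-x) ∂P := by
    conv_lhs => rw [← hP.symm]
    exact (Homeomorph.neg ℝ).measurableEmbedding.integral_map _
  simp_rw [hφ, integral_neg] at h
  linarith

lemma SymmSubWeibull.measure_tail (hP : SymmSubWeibull α τ P) {t : ℝ} (ht : 0 ≤ t) :
    P {x : ℝ | t ≤ |x|} ≤ ENNReal.ofReal (2 * Real.exp (-2 * (t / τ) ^ α)) := by
  have := hP.isProb
  rw [← ofReal_measureReal]
  exact ENNReal.ofReal_le_ofReal (hP.tail t ht)

/-- Layer-cake formula with the tail bound inserted; the resulting integral involves only `α` and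
`τ`. -/
lemma exists_lintegral_pow_four_le (hα : 0 < α) (hτ : 0 < τ) :
    ∃ M : ℝ, 0 ≤ M ∧ ∀ P : Measure ℝ, SymmSubWeibull α τ P →
      ∫⁻ x, ENNReal.ofReal (x ^ 4) ∂P ≤ ENNReal.ofReal M := by
  set b : ℝ := 2 / τ ^ α with hb
  have hτα := Real.rpow_pos_of_pos hτ α
  have hbpos : 0 < b := by positivity
  have hint : IntegrableOn (fun t : ℝ => t ^ (3 : ℝ) * Real.exp (-b * t ^ α)) (Set.Ioi 0) :=
    integrableOn_rpow_mul_exp_neg_mul_rpow (by norm_num) hα hbpos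
  refine ⟨4 * (2 * ∫ t in Set.Ioi (0 : ℝ), t ^ (3 : ℝ) * Real.exp (-b * t ^ α)), ?_, ?_⟩
  · have : 0 ≤ ∫ t in Set.Ioi (0 : ℝ), t ^ (3 : ℝ) * Real.exp (-b * t ^ α) :=
      setIntegral_nonneg measurableSet_Ioi fun t ht => by
        have : (0 : ℝ) < t := ht
        positivity
    positivity
  intro P hP
  have h1 := lintegral_rpow_eq_lintegral_meas_le_mul P (f := fun x : ℝ => |x|)
    (ae_of_all _ fun x => abs_nonneg x) (by fun_prop) (p := 4) (by norm_num)
  have h2 : ∫⁻ x, ENNReal.ofReal (x ^ 4) ∂P = ∫⁻ x, ENNReal.ofReal (|x| ^ (4 : ℝ)) ∂P := by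
    refine lintegral_congr fun x => ?_
    congr 1
    rw [← Even.pow_abs (by decide : Even 4) x]
    exact (Real.rpow_natCast |x| 4).symm
  rw [h2, h1, ENNReal.ofReal_mul (by norm_num)]
  refine mul_le_mul_right ?_ _
  rw [← integral_const_mul, ofReal_integral_eq_lintegral_ofReal (hint.const_mul 2)]
  · refine setLIntegral_mono' measurableSet_Ioi fun t ht => ?_
    have ht0 : (0 : ℝ) < t := ht
    refine (mul_le_mul_left (hP.measure_tail ht0.le) _).trans ?_
    rw [← ENNReal.ofReal_mul (by positivity), Real.div_rpow ht0.le hτ.le]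
    refine ENNReal.ofReal_le_ofReal (le_of_eq ?_)
    rw [hb]
    norm_num
    ring_nf
  · refine (ae_restrict_iff' measurableSet_Ioi).2 (ae_of_all _ fun t ht => ?_)
    have : (0 : ℝ) < t := ht
    simp only [Pi.zero_apply]
    positivity

/-- Cauchy–Schwarz between `x²` and the indicator of the tail. The square root halves the exponent
`-2u^α`, leaving exactly the weight that appears in `ν`. -/
lemma exists_integral_sq_tail_le (hα : 0 < α) (hτ : 0 < τ) :
    ∃ C : ℝ, 0 ≤ C ∧ ∀ P : Measure ℝ, SymmSubWeibull α τ P → ∀ u : ℝ, 0 ≤ u →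
      ∫ x, (if τ * u < |x| then x ^ 2 else 0) ∂P ≤ C * Real.exp (-u ^ α) := by
  obtain ⟨M, hM0, hM⟩ := exists_lintegral_pow_four_le hα hτ
  refine ⟨√(2 * M), by positivity, fun P hP u hu => ?_⟩
  set A : Set ℝ := {x | τ * u < |x|} with hA
  have hAm : MeasurableSet A := measurableSet_lt measurable_const (by fun_prop)
  have hcs := sq_lintegral_mul_le P (f := fun x : ℝ => ENNReal.ofReal (x ^ 2))
    (g := A.indicator 1) (by fun_prop) ((measurable_one.indicator hAm).aemeasurable)
  have e1 : ∫⁻ x, ENNReal.ofReal (x ^ 2) * A.indicator 1 x ∂P =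
      ∫⁻ x, ENNReal.ofReal (if τ * u < |x| then x ^ 2 else 0) ∂P := by
    refine lintegral_congr fun x => ?_
    by_cases h : τ * u < |x| <;> simp [hA, h]
  have e2 : ∫⁻ x, ENNReal.ofReal (x ^ 2) ^ 2 ∂P = ∫⁻ x, ENNReal.ofReal (x ^ 4) ∂P := by
    refine lintegral_congr fun x => ?_
    rw [← ENNReal.ofReal_pow (by positivity)]
    ring_nf
  have e3 : ∫⁻ x, (A.indicator 1 x : ℝ≥0∞) ^ 2 ∂P = P A := by
    rw [← lintegral_indicator_one hAm]
    refine lintegral_congr fun x => ?_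
    by_cases h : x ∈ A <;> simp [h]
  have hPA : P A ≤ ENNReal.ofReal (2 * Real.exp (-2 * u ^ α)) := by
    refine (measure_mono fun x (hx : τ * u < |x|) => hx.le).trans
      ((hP.measure_tail (t := τ * u) (by positivity)).trans_eq ?_)
    rw [mul_div_cancel_left₀ _ hτ.ne']
  rw [e1, e2, e3] at hcs
  have h4 : (∫⁻ x, ENNReal.ofReal (if τ * u < |x| then x ^ 2 else 0) ∂P) ^ 2 ≤
      ENNReal.ofReal (√(2 * M) * Real.exp (-u ^ α)) ^ 2 := by
    refine (hcs.trans (mul_le_mul' (hM P hP) hPA)).trans_eq ?_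
    rw [← ENNReal.ofReal_mul hM0, ← ENNReal.ofReal_pow (by positivity), mul_pow,
      Real.sq_sqrt (by positivity), sq (Real.exp _), ← Real.exp_add]
    ring_nf
  have h5 := (ENNReal.pow_right_strictMono (n := 2) two_ne_zero).le_iff_le.1 h4
  rw [integral_eq_lintegral_of_nonneg_ae (ae_of_all _ fun x => by
    dsimp only [Pi.zero_apply]; split_ifs <;> positivity)
    (Measurable.ite hAm (by fun_prop) measurable_const).aestronglyMeasurable]
  exact ENNReal.toReal_le_of_le_ofReal (by positivity) h5

end Noise

/-! ### Risk of the thresholding estimator -/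

section UpperBound

variable {d : ℕ} {α τ σ : ℝ} {η : Fin d → ℝ} {s : ℕ}

/-- The ordering makes the indices with `|η_j| ≥ λ_o` an initial segment, so the cutoff is a
condition on each coordinate alone. The shift by one is due to `Fin d` starting at zero. -/
lemma succ_le_j1_iff (hanti : Antitone (fun j => |η j|)) (j : Fin d) :
    (j : ℕ) + 1 ≤ j1 α η s ↔ lambdaO α η s ≤ |η j| := by
  classical
  constructor
  · intro h
    have h' : (j : ℕ) < j1 α η s := h
    rw [j1, Finset.lt_sup_iff] at h'
    obtain ⟨i, hi, hij⟩ := h'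
    have hi' := (Finset.mem_filter.1 hi).2
    refine hi'.trans (hanti (Fin.le_def.2 (by omega)))
  · intro h
    exact Finset.le_sup (f := fun j : Fin d => (j : ℕ) + 1)
      (Finset.mem_filter.2 ⟨Finset.mem_univ _, h⟩)

lemma measurable_estimator : Measurable (estimator α τ σ η s) := by
  unfold estimator
  refine Finset.measurable_sum _ fun j _ => ?_
  by_cases h : (j : ℕ) + 1 ≤ j1 α η s
  · simp only [h, if_true]
    fun_prop
  · simp only [h, if_false]
    exact Measurable.ite (measurableSet_lt measurable_const (by fun_prop)) (by fun_prop)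
      measurable_const

/-- The contribution of coordinate `j` to the centered stochastic part of the error. -/
def noisePart (τ l η θ x : ℝ) : ℝ :=
  if l ≤ |η| then η * x else if θ ≠ 0 then 0 else if τ * l < |η * x| then η * x else 0

/-- Symmetric noise then makes every such part centered, so no bias accumulates over the
coordinates. -/
lemma noisePart_neg (τ l η θ x : ℝ) : noisePart τ l η θ (-x) = -noisePart τ l η θ x := by
  unfold noisePart
  simp only [mul_neg, abs_neg]
  split_ifs <;> simp

lemma measurable_noisePart (τ l η θ : ℝ) : Measurable (noisePart τ l η θ) := by
  unfold noisePart
  by_cases h : l ≤ |η|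
  · simp only [h, if_true]; fun_prop
  by_cases h' : θ = 0
  swap
  · simp [h, h']
  · simp only [h, h', if_false, ne_eq, not_true_eq_false]
    exact Measurable.ite (measurableSet_lt measurable_const (by fun_prop)) (by fun_prop)
      measurable_const

lemma noisePart_sq_le (τ l η θ x : ℝ) : noisePart τ l η θ x ^ 2 ≤ η ^ 2 * x ^ 2 := by
  unfold noisePart
  split_ifs <;> nlinarith [sq_nonneg (η * x)]

/-- Only a support coordinate with `|η| < l` leaves a remainder: if kept, its error is `|ησx| ≤
σl|x|`; if killed, `|ηy| ≤ στl` adds at most `στl`. -/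
lemma abs_threshold_sub_le (hτ : 0 < τ) (hσ : 0 < σ) {l : ℝ} (hl : 0 ≤ l) (η θ x : ℝ) :
    |(if l ≤ |η| then η * (θ + σ * x)
      else if σ * τ * l < |η * (θ + σ * x)| then η * (θ + σ * x) else 0)
      - η * θ - σ * noisePart τ l η θ x| ≤ if θ ≠ 0 then σ * l * (|x| + τ) else 0 := by
  unfold noisePart
  by_cases h1 : l ≤ |η|
  · simp only [h1, if_true]
    rw [show η * (θ + σ * x) - η * θ - σ * (η * x) = 0 by ring, abs_zero]
    split_ifs <;> positivity
  simp only [h1, if_false]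
  push Not at h1
  by_cases h2 : θ = 0
  · subst h2
    have : σ * τ * l < |η * (0 + σ * x)| ↔ τ * l < |η * x| := by
      rw [zero_add, show η * (σ * x) = σ * (η * x) by ring, abs_mul, abs_of_pos hσ, mul_assoc,
        mul_lt_mul_iff_right₀ hσ]
    simp only [this, ne_eq, not_true_eq_false, if_false]
    split_ifs
    · rw [show η * (0 + σ * x) - η * 0 - σ * (η * x) = 0 by ring, abs_zero]
    · simp
  · simp only [ne_eq, h2, not_false_eq_true, if_true, mul_zero, sub_zero]
    have hb : |η * (σ * x)| ≤ σ * l * |x| := by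
      rw [abs_mul, abs_mul, abs_of_pos hσ]
      nlinarith [mul_nonneg (mul_nonneg hσ.le (abs_nonneg x)) (sub_nonneg.2 h1.le)]
    split_ifs with h3
    · rw [show η * (θ + σ * x) - η * θ = η * (σ * x) by ring]
      have : 0 ≤ σ * l * τ := by positivity
      linarith
    · push Not at h3
      rw [show 0 - η * θ = η * (σ * x) - η * (θ + σ * x) by ring]
      refine (abs_sub _ _).trans ?_
      linarith

lemma exists_integral_noisePart_sq_le (hα : 0 < α) (hτ : 0 < τ) :
    ∃ C : ℝ, 0 ≤ C ∧ ∀ P : Measure ℝ, SymmSubWeibull α τ P → ∀ l η θ : ℝ, 0 ≤ l → η ≠ 0 →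
      ∫ x, noisePart τ l η θ x ^ 2 ∂P ≤ C * (η ^ 2 * Real.exp (-(l / |η|) ^ α)) := by
  obtain ⟨C, hC0, hC⟩ := exists_integral_sq_tail_le hα hτ
  -- The summand `exp 1` serves the plug-in range: there `(l/|η|)^α ≤ 1`, so the weight is at least
  -- `exp(-1)`.
  refine ⟨C + Real.exp 1, by positivity, fun P hP l η θ hl hη => ?_⟩
  have ha : 0 < |η| := abs_pos.2 hη
  have hE : 0 ≤ η ^ 2 * Real.exp (-(l / |η|) ^ α) := by positivity
  have hexp : 0 < Real.exp 1 := Real.exp_pos 1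
  by_cases h1 : l ≤ |η|
  · simp only [noisePart, h1, if_true, mul_pow, integral_const_mul, hP.second_moment, mul_one]
    have h2 : (l / |η|) ^ α ≤ 1 :=
      Real.rpow_le_one (by positivity) ((div_le_one ha).2 h1) hα.le
    have h3 : 1 ≤ Real.exp 1 * Real.exp (-(l / |η|) ^ α) := by
      rw [← Real.exp_add]
      exact Real.one_le_exp (by linarith)
    nlinarith [mul_le_mul_of_nonneg_left h3 (sq_nonneg η), mul_nonneg hC0 hE]
  simp only [noisePart, h1, if_false]
  by_cases h2 : θ = 0
  · subst h2
    have e : ∀ x : ℝ, (if (0 : ℝ) ≠ 0 then 0 else if τ * l < |η * x| then η * x else 0) ^ 2 =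
        η ^ 2 * (if τ * (l / |η|) < |x| then x ^ 2 else 0) := by
      intro x
      have : τ * l < |η * x| ↔ τ * (l / |η|) < |x| := by
        rw [abs_mul, ← mul_div_assoc, div_lt_iff₀ ha, mul_comm |x|]
      simp only [this, ne_eq, not_true_eq_false, if_false]
      split_ifs <;> ring
    simp_rw [e, integral_const_mul]
    have := mul_le_mul_of_nonneg_left (hC P hP (l / |η|) (by positivity)) (sq_nonneg η)
    nlinarith [mul_nonneg hexp.le hE]
  · simp only [ne_eq, h2, not_false_eq_true, if_true]
    simp only [ne_eq, OfNat.ofNat_ne_zero, not_false_eq_true, zero_pow, integral_zero]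
    positivity

/-- The second moment of a sum of independent centered variables. -/
lemma integral_sq_sum_pi {P : Fin d → Measure ℝ} [∀ j, IsProbabilityMeasure (P j)]
    {φ : Fin d → ℝ → ℝ} (hφ : ∀ j, MemLp (φ j) 2 (P j)) (h0 : ∀ j, ∫ x, φ j x ∂(P j) = 0) :
    ∫ ξ, (∑ j, φ j (ξ j)) ^ 2 ∂(Measure.pi P) = ∑ j, ∫ x, φ j x ^ 2 ∂(P j) := by
  have hL : ∀ j, MemLp (fun ξ : Fin d → ℝ => φ j (ξ j)) 2 (Measure.pi P) := fun j =>
    (hφ j).comp_measurePreserving (measurePreserving_eval P j)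
  have hcomp : ∀ j, ∫ ξ : Fin d → ℝ, φ j (ξ j) ∂(Measure.pi P) = 0 := fun j =>
    (integral_comp_eval (hφ j).1).trans (h0 j)
  have hv := ProbabilityTheory.variance_sum_pi hφ
  have e : (∑ j, fun ξ : Fin d → ℝ => φ j (ξ j)) = fun ξ => ∑ j, φ j (ξ j) := by
    ext ξ; simp
  rw [e, ProbabilityTheory.variance_of_integral_eq_zero] at hv
  · rw [hv]
    refine Finset.sum_congr rfl fun j _ => ?_
    rw [ProbabilityTheory.variance_of_integral_eq_zero (hφ j).1.aemeasurable (h0 j)]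
  · exact Finset.aemeasurable_fun_sum _ fun j _ => (hL j).1.aemeasurable
  · rw [integral_finsetSum _ fun j _ => (hL j).integrable (by norm_num)]
    exact Finset.sum_eq_zero fun j _ => hcomp j

lemma mse_eq (hT : Measurable T) (θ : Fin d → ℝ) (P : Fin d → Measure ℝ) :
    mse σ η T θ P = ∫⁻ ξ, ENNReal.ofReal ((T (fun j => θ j + σ * ξ j) - linFun η θ) ^ 2)
      ∂(Measure.pi P) := by
  unfold mse obsLaw
  rw [lintegral_map (by fun_prop) (by fun_prop)]

lemma estimator_error_sq_le (hτ : 0 < τ) (hσ : 0 < σ) (hanti : Antitone (fun j => |η j|))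
    {θ : Fin d → ℝ} (hθ : θ ∈ sparseSet d s) (ξ : Fin d → ℝ) :
    (estimator α τ σ η s (fun j => θ j + σ * ξ j) - linFun η θ) ^ 2 ≤
      2 * σ ^ 2 * (∑ j, noisePart τ (lambdaO α η s) (η j) (θ j) (ξ j)) ^ 2 +
        4 * σ ^ 2 * lambdaO α η s ^ 2 * s *
          ∑ j with θ j ≠ 0, ((ξ j) ^ 2 + τ ^ 2) := by
  classical
  set l := lambdaO α η s with hl
  have hl0 : 0 ≤ l := lambdaO_nonneg s
  set N := ∑ j, noisePart τ l (η j) (θ j) (ξ j)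
  have hcard : ((Finset.univ.filter fun j => θ j ≠ 0).card : ℝ) ≤ s := by
    have h : zeroNorm θ ≤ s := hθ
    rw [zeroNorm, Set.ncard_eq_toFinset_card'] at h
    exact_mod_cast (by simpa using h)
  have h1 : |estimator α τ σ η s (fun j => θ j + σ * ξ j) - linFun η θ - σ * N| ≤
      σ * l * ∑ j with θ j ≠ 0, (|ξ j| + τ) := by
    simp only [estimator, linFun, N, succ_le_j1_iff hanti, Finset.mul_sum]
    rw [← Finset.sum_sub_distrib, ← Finset.sum_sub_distrib]
    refine (Finset.abs_sum_le_sum_abs _ _).trans ?_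
    rw [Finset.sum_filter]
    exact Finset.sum_le_sum fun j _ => abs_threshold_sub_le hτ hσ hl0 _ _ _
  set E := estimator α τ σ η s (fun j => θ j + σ * ξ j) - linFun η θ
  have h2 : (∑ j with θ j ≠ 0, (|ξ j| + τ)) ^ 2 ≤
      s * ∑ j with θ j ≠ 0, 2 * ((ξ j) ^ 2 + τ ^ 2) := by
    refine sq_sum_le_card_mul_sum_sq.trans ?_
    refine mul_le_mul hcard (Finset.sum_le_sum fun j _ => ?_)
      (Finset.sum_nonneg fun j _ => sq_nonneg _) (Nat.cast_nonneg s)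
    rw [← sq_abs (ξ j)]
    nlinarith [sq_nonneg (|ξ j| - τ)]
  rw [← Finset.mul_sum] at h2
  have h3 : (E - σ * N) ^ 2 ≤ σ ^ 2 * l ^ 2 * (s * (2 * ∑ j with θ j ≠ 0, ((ξ j) ^ 2 + τ ^ 2))) := by
    rw [← sq_abs]
    refine (pow_le_pow_left₀ (abs_nonneg _) h1 2).trans ?_
    rw [mul_pow, mul_pow]
    gcongr
  -- The hint is the identity `2a² + 2(E-a)² - E² = (E-2a)²` with `a = σN`.
  nlinarith [sq_nonneg (E - 2 * (σ * N))]

theorem exists_maxRisk_estimator_le (hα : 0 < α) (hτ : 0 < τ) :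
    ∃ C : ℝ, 0 < C ∧ ∀ (d : ℕ) (η : Fin d → ℝ), (∀ j, η j ≠ 0) → Antitone (fun j => |η j|) →
      ∀ (s : ℕ) (σ : ℝ), 0 < σ →
        maxRisk α τ σ η s (estimator α τ σ η s) ≤ ENNReal.ofReal (C * σ ^ 2 * phiO α η s) := by
  classical
  obtain ⟨C, hC0, hC⟩ := exists_integral_noisePart_sq_le hα hτ
  refine ⟨2 * C + 4 * (1 + τ ^ 2), by positivity, fun d η hη hanti s σ hσ => ?_⟩
  refine iSup₂_le fun θ hθ => iSup₂_le fun P hP => ?_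
  have hprob : ∀ j, IsProbabilityMeasure (P j) := fun j => (hP j).isProb
  rw [mse_eq measurable_estimator]
  set l := lambdaO α η s with hl
  have hl0 : 0 ≤ l := lambdaO_nonneg s
  have hφ : ∀ j, MemLp (noisePart τ l (η j) (θ j)) 2 (P j) := fun j => by
    rw [memLp_two_iff_integrable_sq (measurable_noisePart _ _ _ _).aestronglyMeasurable]
    refine ((hP j).integrable_sq.const_mul (η j ^ 2)).mono'
      ((measurable_noisePart _ _ _ _).pow_const 2).aestronglyMeasurable (ae_of_all _ fun x => ?_)
    rw [Real.norm_eq_abs, abs_of_nonneg (sq_nonneg _)]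
    exact noisePart_sq_le _ _ _ _ _
  have hsum : MemLp (fun ξ : Fin d → ℝ => ∑ j, noisePart τ l (η j) (θ j) (ξ j)) 2
      (Measure.pi P) :=
    memLp_finsetSum _ fun j _ => (hφ j).comp_measurePreserving (measurePreserving_eval P j)
  have hint1 : Integrable (fun ξ : Fin d → ℝ =>
      (∑ j, noisePart τ l (η j) (θ j) (ξ j)) ^ 2) (Measure.pi P) := hsum.integrable_sq
  have hint2 : ∀ j, Integrable (fun ξ : Fin d → ℝ => (ξ j) ^ 2 + τ ^ 2) (Measure.pi P) :=
    fun j => ((measurePreserving_eval P j).integrable_comp_of_integrable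
      (hP j).integrable_sq).add (integrable_const _)
  have hval : ∀ j, ∫ ξ : Fin d → ℝ, ((ξ j) ^ 2 + τ ^ 2) ∂(Measure.pi P) = 1 + τ ^ 2 := fun j => by
    refine (integral_comp_eval (μ := P) (i := j) (f := fun x : ℝ => x ^ 2 + τ ^ 2)
      (by fun_prop)).trans ?_
    rw [integral_add (hP j).integrable_sq (integrable_const _), (hP j).second_moment]
    simp
  have hcard : ((Finset.univ.filter fun j => θ j ≠ 0).card : ℝ) ≤ s := by
    have h : zeroNorm θ ≤ s := hθ
    rw [zeroNorm, Set.ncard_eq_toFinset_card'] at h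
    exact_mod_cast (by simpa using h)
  refine (lintegral_mono fun ξ => ENNReal.ofReal_le_ofReal
    (estimator_error_sq_le hτ hσ hanti hθ ξ)).trans ?_
  have hint3 := integrable_finsetSum (Finset.univ.filter fun j => θ j ≠ 0) fun j _ => hint2 j
  refine (ofReal_integral_eq_lintegral_ofReal
    ((hint1.const_mul (2 * σ ^ 2)).add (hint3.const_mul (4 * σ ^ 2 * l ^ 2 * s)))
    (ae_of_all _ fun ξ => by dsimp only [Pi.zero_apply, Pi.add_apply]; positivity)).symm.trans_le ?_
  refine ENNReal.ofReal_le_ofReal ?_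
  rw [integral_add' (hint1.const_mul _) (hint3.const_mul _), integral_const_mul,
    integral_const_mul, integral_finsetSum _ fun j _ => hint2 j,
    integral_sq_sum_pi hφ fun j => (hP j).integral_eq_zero_of_odd (noisePart_neg _ _ _ _)]
  simp only [hval, Finset.sum_const, nsmul_eq_mul]
  have h1 : ∑ j, ∫ x, noisePart τ l (η j) (θ j) x ^ 2 ∂(P j) ≤ C * nu α η s ^ 2 := by
    rw [nu_sq, Finset.mul_sum]
    exact Finset.sum_le_sum fun j _ => hC _ (hP j) _ _ _ hl0 (hη j)
  have hnu : 0 ≤ nu α η s := Real.sqrt_nonneg _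
  calc 2 * σ ^ 2 * ∑ j, ∫ x, noisePart τ l (η j) (θ j) x ^ 2 ∂(P j) +
        4 * σ ^ 2 * l ^ 2 * s * ((Finset.univ.filter fun j => θ j ≠ 0).card * (1 + τ ^ 2))
      ≤ 2 * σ ^ 2 * (C * nu α η s ^ 2) + 4 * σ ^ 2 * l ^ 2 * s * (s * (1 + τ ^ 2)) := by gcongr
    _ = 2 * C * σ ^ 2 * nu α η s ^ 2 + 4 * (1 + τ ^ 2) * σ ^ 2 * (l * s) ^ 2 := by ring
    _ ≤ 2 * C * σ ^ 2 * (l * s + nu α η s) ^ 2 +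
        4 * (1 + τ ^ 2) * σ ^ 2 * (l * s + nu α η s) ^ 2 := by
      have : 0 ≤ l * s := by positivity
      gcongr <;> linarith
    _ = (2 * C + 4 * (1 + τ ^ 2)) * σ ^ 2 * phiO α η s := by rw [phiO]; ring

end UpperBound

/-! ### The least favourable noise law and its translates -/

section NoiseLaw

variable {α c : ℝ}

lemma integral_abs_rpow_mul_exp (hα : 0 < α) (hc : 0 < c) {q : ℝ} (hq : -1 < q) :
    ∫ x : ℝ, |x| ^ q * Real.exp (-c * |x| ^ α) =
      2 * (c ^ (-(q + 1) / α) * (1 / α) * Real.Gamma ((q + 1) / α)) := by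
  rw [integral_comp_abs (f := fun x => x ^ q * Real.exp (-c * x ^ α)),
    integral_rpow_mul_exp_neg_mul_rpow hα hq hc]

lemma integral_abs_rpow_mul_exp_pos (hα : 0 < α) (hc : 0 < c) {q : ℝ} (hq : -1 < q) :
    0 < ∫ x : ℝ, |x| ^ q * Real.exp (-c * |x| ^ α) := by
  rw [integral_abs_rpow_mul_exp hα hc hq]
  have := Real.Gamma_pos_of_pos (s := (q + 1) / α) (div_pos (by linarith) hα)
  positivity

lemma integrable_abs_rpow_mul_exp (hα : 0 < α) (hc : 0 < c) {q : ℝ} (hq : -1 < q) :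
    Integrable (fun x : ℝ => |x| ^ q * Real.exp (-c * |x| ^ α)) := by
  -- A non-integrable function has Bochner integral `0`, against positivity.
  by_contra h
  exact (integral_abs_rpow_mul_exp_pos hα hc hq).ne' (integral_undef h)

lemma integral_exp_abs_pos (hα : 0 < α) (hc : 0 < c) :
    0 < ∫ x : ℝ, Real.exp (-c * |x| ^ α) := by
  simpa using integral_abs_rpow_mul_exp_pos hα hc (q := 0) (by norm_num)

lemma integrable_exp_abs (hα : 0 < α) (hc : 0 < c) :
    Integrable (fun x : ℝ => Real.exp (-c * |x| ^ α)) := by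
  simpa using integrable_abs_rpow_mul_exp hα hc (q := 0) (by norm_num)

/-- The variance of the law is `c^(-2/α) Γ(3/α)/Γ(1/α)`; equating it to `1` determines `c`. -/
lemma exists_scale (hα : 0 < α) : ∃ c : ℝ, 0 < c ∧
    ∫ x : ℝ, x ^ 2 * Real.exp (-c * |x| ^ α) = ∫ x : ℝ, Real.exp (-c * |x| ^ α) := by
  have h1 := Real.Gamma_pos_of_pos (s := 1 / α) (by positivity)
  have h3 := Real.Gamma_pos_of_pos (s := 3 / α) (by positivity)
  set r := Real.Gamma (3 / α) / Real.Gamma (1 / α) with hr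
  have hr0 : 0 < r := by positivity
  refine ⟨r ^ (α / 2), by positivity, ?_⟩
  have hc : 0 < r ^ (α / 2) := by positivity
  have e2 := integral_abs_rpow_mul_exp hα hc (q := 2) (by norm_num)
  have e0 := integral_abs_rpow_mul_exp hα hc (q := 0) (by norm_num)
  simp only [Real.rpow_zero, one_mul, Real.rpow_ofNat, sq_abs] at e2 e0
  rw [e2, e0, ← Real.rpow_mul hr0.le, ← Real.rpow_mul hr0.le]
  have x1 : α / 2 * (-(2 + 1) / α) = -1 + -1 / 2 := by field_simp; norm_num
  have x2 : α / 2 * (-(0 + 1) / α) = -1 / 2 := by field_simp; norm_num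
  rw [x1, x2, Real.rpow_add hr0, Real.rpow_neg_one, show (2 + 1 : ℝ) = 3 by norm_num, zero_add]
  have : r⁻¹ * Real.Gamma (3 / α) = Real.Gamma (1 / α) := by
    rw [hr]; field_simp
  rw [← this]
  ring

lemma map_withDensity_comp {Ω Ω' : Type*} [MeasurableSpace Ω] [MeasurableSpace Ω']
    {μ : Measure Ω} {ν : Measure Ω'} {g : Ω → Ω'} (hg : MeasurePreserving g μ ν)
    {f : Ω' → ℝ≥0∞} (hf : Measurable f) :
    (μ.withDensity (fun x => f (g x))).map g = ν.withDensity f := by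
  ext s hs
  rw [Measure.map_apply hg.measurable hs, withDensity_apply _ (hg.measurable hs),
    withDensity_apply _ hs, hg.setLIntegral_comp_preimage hs hf]

/-- The density proportional to `exp(-c |x|^α)`. -/
def weibullDensity (α c x : ℝ) : ℝ≥0∞ :=
  ENNReal.ofReal ((∫ x : ℝ, Real.exp (-c * |x| ^ α))⁻¹ * Real.exp (-c * |x| ^ α))

/-- The law on the line with density proportional to `exp(-c |x|^α)`. -/
def weibullLaw (α c : ℝ) : Measure ℝ := volume.withDensity (weibullDensity α c)

/-- The likelihood ratio of the translate by `h` of `weibullLaw α c`. -/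
def shiftRatio (α c h x : ℝ) : ℝ≥0∞ :=
  ENNReal.ofReal (Real.exp (c * |x| ^ α - c * |x - h| ^ α))

@[fun_prop]
lemma measurable_weibullDensity : Measurable (weibullDensity α c) := by
  unfold weibullDensity; fun_prop

lemma measurable_shiftRatio (h : ℝ) : Measurable (shiftRatio α c h) := by
  unfold shiftRatio; fun_prop

lemma shiftRatio_zero (x : ℝ) : shiftRatio α c 0 x = 1 := by
  simp [shiftRatio]

lemma isProbabilityMeasure_weibullLaw (hα : 0 < α) (hc : 0 < c) :
    IsProbabilityMeasure (weibullLaw α c) := by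
  constructor
  have hZ := integral_exp_abs_pos hα hc
  rw [weibullLaw, withDensity_apply _ MeasurableSet.univ, setLIntegral_univ]
  unfold weibullDensity
  rw [← ofReal_integral_eq_lintegral_ofReal ((integrable_exp_abs hα hc).const_mul _)
    (ae_of_all _ fun x => by dsimp only [Pi.zero_apply]; positivity), integral_const_mul,
    inv_mul_cancel₀ hZ.ne', ENNReal.ofReal_one]

lemma weibullLaw_map_neg : (weibullLaw α c).map (fun x : ℝ => -x) = weibullLaw α c := by
  have h := map_withDensity_comp (Measure.measurePreserving_neg (volume : Measure ℝ))
    (measurable_weibullDensity (α := α) (c := c))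
  have e : (fun x => weibullDensity α c (-x)) = weibullDensity α c := by
    ext x; simp [weibullDensity]
  rwa [e] at h

lemma weibullLaw_map_add (hα : 0 < α) (hc : 0 < c) (h : ℝ) :
    (weibullLaw α c).map (fun x : ℝ => h + x) =
      (weibullLaw α c).withDensity (shiftRatio α c h) := by
  have hZ := integral_exp_abs_pos hα hc
  have h1 := map_withDensity_comp (measurePreserving_add_left (volume : Measure ℝ) h)
    (f := fun x => weibullDensity α c (x - h)) (by fun_prop)
  simp only [add_sub_cancel_left] at h1
  refine h1.trans ?_
  rw [weibullLaw, ← withDensity_mul _ measurable_weibullDensity (measurable_shiftRatio h)]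
  congr 1
  ext x
  rw [Pi.mul_apply, weibullDensity, weibullDensity, shiftRatio, ← ENNReal.ofReal_mul (by positivity),
    mul_assoc, ← Real.exp_add]
  ring_nf

lemma integral_sq_weibullLaw (hα : 0 < α) (hc : 0 < c)
    (h : ∫ x : ℝ, x ^ 2 * Real.exp (-c * |x| ^ α) = ∫ x : ℝ, Real.exp (-c * |x| ^ α)) :
    ∫ x, x ^ 2 ∂(weibullLaw α c) = 1 := by
  have hZ := integral_exp_abs_pos hα hc
  rw [weibullLaw, integral_withDensity_eq_integral_toReal_smul measurable_weibullDensity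
    (ae_of_all _ fun x => ENNReal.ofReal_lt_top)]
  have : ∀ x : ℝ, (weibullDensity α c x).toReal • x ^ 2 =
      (∫ x : ℝ, Real.exp (-c * |x| ^ α))⁻¹ * (x ^ 2 * Real.exp (-c * |x| ^ α)) := fun x => by
    rw [weibullDensity, ENNReal.toReal_ofReal (by positivity), smul_eq_mul]
    ring
  simp_rw [this, integral_const_mul, h]
  exact inv_mul_cancel₀ hZ.ne'

/-- The ratio of the normalizing constants for `c / 2` and `c`. -/
def halfRatio (α c : ℝ) : ℝ :=
  (∫ x : ℝ, Real.exp (-c * |x| ^ α))⁻¹ * ∫ x : ℝ, Real.exp (-(c / 2) * |x| ^ α)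

lemma halfRatio_pos (hα : 0 < α) (hc : 0 < c) : 0 < halfRatio α c :=
  mul_pos (inv_pos.2 (integral_exp_abs_pos hα hc)) (integral_exp_abs_pos hα (half_pos hc))

lemma lintegral_halfRatio (hα : 0 < α) (hc : 0 < c) {b : ℝ} (hb : 0 ≤ b) (h : ℝ) :
    ∫⁻ x : ℝ, ENNReal.ofReal (b * ((∫ x : ℝ, Real.exp (-c * |x| ^ α))⁻¹ *
      Real.exp (-(c / 2) * |x - h| ^ α))) = ENNReal.ofReal (b * halfRatio α c) := by
  have hZ := integral_exp_abs_pos hα hc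
  rw [lintegral_sub_right_eq_self (fun x : ℝ => ENNReal.ofReal
    (b * ((∫ x : ℝ, Real.exp (-c * |x| ^ α))⁻¹ * Real.exp (-(c / 2) * |x| ^ α)))) h,
    ← ofReal_integral_eq_lintegral_ofReal
      (((integrable_exp_abs hα (half_pos hc)).const_mul _).const_mul _)
      (ae_of_all _ fun x => by dsimp only [Pi.zero_apply]; positivity),
    integral_const_mul, integral_const_mul, halfRatio]

/-- Half of the exponent supplies the decay, the other half is integrated. -/
lemma weibullLaw_tail_le (hα : 0 < α) (hc : 0 < c) {t : ℝ} (ht : 0 ≤ t) :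
    (weibullLaw α c).real {x | t ≤ |x|} ≤ Real.exp (-(c / 2) * t ^ α) * halfRatio α c := by
  have hZ := integral_exp_abs_pos hα hc
  refine ENNReal.toReal_le_of_le_ofReal (mul_pos (Real.exp_pos _) (halfRatio_pos hα hc)).le ?_
  have hm : MeasurableSet {x : ℝ | t ≤ |x|} := measurableSet_le measurable_const (by fun_prop)
  rw [weibullLaw, withDensity_apply _ hm, ← lintegral_halfRatio hα hc (Real.exp_pos _).le 0]
  refine (setLIntegral_mono' hm fun x hx => ?_).trans (setLIntegral_le_lintegral _ _)
  refine ENNReal.ofReal_le_ofReal ?_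
  rw [sub_zero, mul_left_comm, ← Real.exp_add]
  have h1 := Real.rpow_le_rpow ht (show t ≤ |x| from hx) hα.le
  have h2 : -c * |x| ^ α ≤ -(c / 2) * t ^ α + -(c / 2) * |x| ^ α := by nlinarith
  gcongr

/-- The tail bound carries a constant `K` that may exceed `2`. A probability `x` satisfies `x ≤ x^p`
for `0 < p ≤ 1`, and `p` is chosen with `K^p ≤ 2`. The exponent becomes `-(pc/2)t^α`, which a large
`τ` absorbs as soon as `τ^α ≥ 4/(pc)`. -/
lemma exists_symmSubWeibull (hα : 0 < α) (hc : 0 < c)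
    (h : ∫ x : ℝ, x ^ 2 * Real.exp (-c * |x| ^ α) = ∫ x : ℝ, Real.exp (-c * |x| ^ α)) :
    ∃ τα : ℝ, 0 < τα ∧ ∀ τ, τα ≤ τ → SymmSubWeibull α τ (weibullLaw α c) := by
  have hprob := isProbabilityMeasure_weibullLaw hα hc
  set K := max (halfRatio α c) 1 with hK
  have hK1 : 1 ≤ K := le_max_right _ _
  have hK0 : 0 < K := by linarith
  have hlogK : 0 ≤ Real.log K := Real.log_nonneg hK1
  have hlog2 : 0 < Real.log 2 := Real.log_pos (by norm_num)
  set p := Real.log 2 / (Real.log 2 + Real.log K) with hp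
  have hp0 : 0 < p := by positivity
  have hp1 : p ≤ 1 := (div_le_one (by positivity)).2 (by linarith)
  have hpK : Real.log K * p ≤ Real.log 2 := by
    rw [hp, ← mul_div_assoc, div_le_iff₀ (by positivity)]
    nlinarith
  have hτ0 : 0 < (4 / (p * c)) ^ (1 / α) := by positivity
  refine ⟨(4 / (p * c)) ^ (1 / α), hτ0, fun τ hτ => ⟨hprob, weibullLaw_map_neg,
    integral_sq_weibullLaw hα hc h, fun t ht => ?_⟩⟩
  have hτpos : 0 < τ := hτ0.trans_le hτ
  have hτα : 4 / (p * c) ≤ τ ^ α := by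
    have := Real.rpow_le_rpow hτ0.le hτ hα.le
    rwa [← Real.rpow_mul (by positivity), one_div_mul_cancel hα.ne', Real.rpow_one] at this
  set x := (weibullLaw α c).real {x | t ≤ |x|} with hx
  have hx0 : 0 ≤ x := measureReal_nonneg
  have hx1 : x ≤ 1 := measureReal_le_one
  have hxK : x ≤ K * Real.exp (-(c / 2) * t ^ α) := by
    refine (weibullLaw_tail_le hα hc ht).trans ?_
    rw [mul_comm]
    gcongr
    exact le_max_left _ _
  have h1 : x ≤ x ^ p := by
    rcases hx0.eq_or_lt with h0 | h0
    · rw [← h0, Real.zero_rpow hp0.ne']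
    · simpa using Real.rpow_le_rpow_of_exponent_ge h0 hx1 hp1
  have h2 : x ^ p ≤ 2 * Real.exp (-(p * c / 2) * t ^ α) := by
    refine (Real.rpow_le_rpow hx0 hxK hp0.le).trans ?_
    rw [Real.mul_rpow hK0.le (Real.exp_pos _).le, ← Real.exp_mul, Real.rpow_def_of_pos hK0]
    have : Real.exp (Real.log K * p) ≤ 2 := by
      rw [← Real.exp_log (show (0 : ℝ) < 2 by norm_num)]
      exact Real.exp_le_exp.2 hpK
    rw [show -(c / 2) * t ^ α * p = -(p * c / 2) * t ^ α by ring]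
    gcongr
  refine h1.trans (h2.trans ?_)
  have hτp := Real.rpow_pos_of_pos hτpos α
  have h3 : -(p * c / 2) * t ^ α ≤ -2 * (t / τ) ^ α := by
    rw [Real.div_rpow ht hτpos.le]
    have h4 : 0 ≤ t ^ α := Real.rpow_nonneg ht α
    have h5 : t ^ α / τ ^ α ≤ t ^ α * (p * c / 4) := by
      rw [div_le_iff₀ hτp, mul_assoc]
      refine le_mul_of_one_le_right h4 ?_
      rw [div_le_iff₀ (by positivity)] at hτα
      linarith
    linarith
  gcongr

/-- With `b^α = 3/2`: either `h` is so small that `|x| ≤ b|x-h|`, or `|x-h|`, hence `|x|`, is at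
most a multiple of `|h|`. -/
lemma exists_rpow_abs_le (hα : 0 < α) : ∃ C : ℝ, 0 < C ∧ ∀ x h : ℝ,
    |x| ^ α ≤ 3 / 2 * |x - h| ^ α + C * |h| ^ α := by
  set b : ℝ := (3 / 2 : ℝ) ^ (1 / α) with hb
  have hb1 : 1 < b := Real.one_lt_rpow (by norm_num) (by positivity)
  have hbα : b ^ α = 3 / 2 := by
    rw [hb, ← Real.rpow_mul (by norm_num), one_div_mul_cancel hα.ne', Real.rpow_one]
  have hb0 : 0 < b - 1 := by linarith
  refine ⟨(1 / (b - 1) + 1) ^ α, by positivity, fun x h => ?_⟩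
  have htri : |x| ≤ |x - h| + |h| := by
    have := abs_add_le (x - h) h
    rwa [sub_add_cancel] at this
  have n1 : 0 ≤ |x - h| ^ α := by positivity
  have n2 : 0 ≤ (1 / (b - 1) + 1) ^ α * |h| ^ α := by positivity
  rcases le_total |h| ((b - 1) * |x - h|) with hh | hh
  · have h1 : |x| ≤ b * |x - h| := by linarith
    have h2 := Real.rpow_le_rpow (abs_nonneg x) h1 hα.le
    rw [Real.mul_rpow (by linarith) (abs_nonneg _), hbα] at h2
    linarith
  · have h1 : |x| ≤ (1 / (b - 1) + 1) * |h| := by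
      have : |x - h| ≤ 1 / (b - 1) * |h| := by
        rw [one_div, ← div_eq_inv_mul, le_div_iff₀ hb0]
        linarith
      linarith
    have h2 := Real.rpow_le_rpow (abs_nonneg x) h1 hα.le
    rw [Real.mul_rpow (by positivity) (abs_nonneg _)] at h2
    linarith

/-- The integrand has exponent `c|x|^α - 2c|x-h|^α`. The factor `3/2 < 2` of `exists_rpow_abs_le`
leaves the integrable `-(c/2)|x-h|^α`. -/
lemma exists_lintegral_shiftRatio_sq_le (hα : 0 < α) (hc : 0 < c) :
    ∃ C : ℝ, 0 < C ∧ ∀ h : ℝ, ∫⁻ x, shiftRatio α c h x ^ 2 ∂(weibullLaw α c) ≤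
      ENNReal.ofReal (Real.exp (C * |h| ^ α) * halfRatio α c) := by
  obtain ⟨C, hC0, hC⟩ := exists_rpow_abs_le hα
  have hZ := integral_exp_abs_pos hα hc
  refine ⟨c * C, by positivity, fun h => ?_⟩
  rw [weibullLaw, lintegral_withDensity_eq_lintegral_mul _ measurable_weibullDensity
    ((measurable_shiftRatio h).pow_const 2), ← lintegral_halfRatio hα hc (Real.exp_pos _).le h]
  refine lintegral_mono fun x => ?_
  rw [Pi.mul_apply, weibullDensity, shiftRatio, ← ENNReal.ofReal_pow (Real.exp_pos _).le,
    ← ENNReal.ofReal_mul (by positivity)]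
  refine ENNReal.ofReal_le_ofReal ?_
  rw [mul_left_comm, mul_assoc, ← Real.exp_add, sq, ← Real.exp_add, ← Real.exp_add]
  have h1 := mul_le_mul_of_nonneg_left (hC x h) hc.le
  have h2 : -c * |x| ^ α + (c * |x| ^ α - c * |x - h| ^ α + (c * |x| ^ α - c * |x - h| ^ α)) ≤
    c * C * |h| ^ α + -(c / 2) * |x - h| ^ α := by linarith
  gcongr

/-- A noise law in the class whose small translates have a controlled `χ²`-divergence. -/
theorem exists_noise (hα : 0 < α) :
    ∃ (P : Measure ℝ) (g : ℝ → ℝ → ℝ≥0∞) (τα κ K : ℝ), 0 < τα ∧ 0 < κ ∧ 0 ≤ K ∧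
      (∀ τ, τα ≤ τ → SymmSubWeibull α τ P) ∧ (∀ h, Measurable (g h)) ∧ (∀ x, g 0 x = 1) ∧
      (∀ h, P.map (fun x => h + x) = P.withDensity (g h)) ∧
      ∀ h u : ℝ, 0 ≤ u → |h| ≤ κ * (u + 1) →
        ∫⁻ x, g h x ^ 2 ∂P ≤ ENNReal.ofReal (K * Real.exp (u ^ α)) := by
  obtain ⟨c, hc, hcs⟩ := exists_scale hα
  obtain ⟨τα, hτ0, hτ⟩ := exists_symmSubWeibull hα hc hcs
  obtain ⟨C, hC0, hC⟩ := exists_lintegral_shiftRatio_sq_le hα hc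
  have hH := halfRatio_pos hα hc
  -- Chosen so that `|h| ≤ κ(u+1)` forces `C|h|^α ≤ u^α + 1`; the extra `1` is the factor `exp 1` in
  -- `K`.
  set κ : ℝ := C⁻¹ ^ (1 / α) / 2 with hκ
  have hκ0 : 0 < κ := by positivity
  refine ⟨weibullLaw α c, shiftRatio α c, τα, κ, Real.exp 1 * halfRatio α c, hτ0, hκ0,
    by positivity, hτ, measurable_shiftRatio, shiftRatio_zero, weibullLaw_map_add hα hc,
    fun h u hu hh => ?_⟩
  refine (hC h).trans (ENNReal.ofReal_le_ofReal ?_)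
  have h1 : |h| ≤ C⁻¹ ^ (1 / α) * max u 1 := by
    have : u + 1 ≤ 2 * max u 1 := by
      have := le_max_left u 1
      have := le_max_right u 1
      linarith
    calc |h| ≤ κ * (u + 1) := hh
      _ ≤ κ * (2 * max u 1) := by gcongr
      _ = _ := by rw [hκ]; ring
  have h2 : |h| ^ α ≤ C⁻¹ * (u ^ α + 1) := by
    refine (Real.rpow_le_rpow (abs_nonneg h) h1 hα.le).trans ?_
    rw [Real.mul_rpow (by positivity) (by positivity), ← Real.rpow_mul (by positivity),
      one_div_mul_cancel hα.ne', Real.rpow_one]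
    have hu' : 0 ≤ u ^ α := Real.rpow_nonneg hu α
    gcongr
    rcases le_total u 1 with h | h
    · rw [max_eq_right h, Real.one_rpow]; linarith
    · rw [max_eq_left h]; linarith
  have h3 : C * |h| ^ α ≤ 1 + u ^ α := by
    have := mul_le_mul_of_nonneg_left h2 hC0.le
    rw [mul_inv_cancel_left₀ hC0.ne'] at this
    linarith
  calc Real.exp (C * |h| ^ α) * halfRatio α c
      ≤ Real.exp (1 + u ^ α) * halfRatio α c := by gcongr
    _ = _ := by rw [Real.exp_add]; ring

end NoiseLaw

/-! ### Densities and translations of product measures -/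

section ProductMeasures

variable {ι : Type*} [Fintype ι] {Ω : ι → Type*} [∀ i, MeasurableSpace (Ω i)]

lemma lintegral_prod_pi (μ : ∀ i, Measure (Ω i)) [∀ i, IsProbabilityMeasure (μ i)]
    {f : ∀ i, Ω i → ℝ≥0∞} (hf : ∀ i, Measurable (f i)) :
    ∫⁻ x, ∏ i, f i (x i) ∂(Measure.pi μ) = ∏ i, ∫⁻ x, f i x ∂(μ i) := by
  rw [ProbabilityTheory.lintegral_prod_eq_prod_lintegral_of_indepFun Finset.univ
    (fun i (x : ∀ i, Ω i) => f i (x i)) (ProbabilityTheory.iIndepFun_pi fun i => (hf i).aemeasurable)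
    (fun i => (hf i).comp (measurable_pi_apply i))]
  refine Finset.prod_congr rfl fun i _ => ?_
  exact (measurePreserving_eval μ i).lintegral_comp (hf i)

lemma pi_withDensity (μ : ∀ i, Measure (Ω i)) [∀ i, IsProbabilityMeasure (μ i)]
    {f : ∀ i, Ω i → ℝ≥0∞} (hf : ∀ i, Measurable (f i))
    [∀ i, SigmaFinite ((μ i).withDensity (f i))] :
    Measure.pi (fun i => (μ i).withDensity (f i)) =
      (Measure.pi μ).withDensity (fun x => ∏ i, f i (x i)) := by
  classical
  refine Measure.pi_eq fun S hS => ?_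
  rw [withDensity_apply _ (MeasurableSet.univ_pi hS),
    ← lintegral_indicator (MeasurableSet.univ_pi hS)]
  have e : ∀ x : ∀ i, Ω i, (Set.univ.pi S).indicator (fun x => ∏ i, f i (x i)) x =
      ∏ i, (S i).indicator (f i) (x i) := fun x => by
    by_cases hx : x ∈ Set.univ.pi S
    · rw [Set.indicator_of_mem hx]
      exact Finset.prod_congr rfl fun i _ => (Set.indicator_of_mem (hx i trivial) _).symm
    · rw [Set.indicator_of_notMem hx]
      simp only [Set.mem_pi, Set.mem_univ, true_imp_iff, not_forall] at hx
      obtain ⟨i, hi⟩ := hx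
      exact (Finset.prod_eq_zero (Finset.mem_univ i) (Set.indicator_of_notMem hi _)).symm
  simp_rw [e]
  rw [lintegral_prod_pi μ fun i => (hf i).indicator (hS i)]
  refine Finset.prod_congr rfl fun i _ => ?_
  rw [lintegral_indicator (hS i), withDensity_apply _ (hS i)]

lemma lintegral_translate_pi {P : Measure ℝ} [IsProbabilityMeasure P] {g : ℝ → ℝ → ℝ≥0∞}
    (hg : ∀ h, Measurable (g h)) (hmap : ∀ h, P.map (fun x => h + x) = P.withDensity (g h))
    (t : ι → ℝ) {F : (ι → ℝ) → ℝ≥0∞} (hF : Measurable F) :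
    ∫⁻ ξ, F (fun i => t i + ξ i) ∂(Measure.pi fun _ : ι => P) =
      ∫⁻ x, (∏ i, g (t i) (x i)) * F x ∂(Measure.pi fun _ : ι => P) := by
  have hpr : ∀ h : ℝ, IsProbabilityMeasure (P.map (fun x => h + x)) := fun h =>
    Measure.isProbabilityMeasure_map (by fun_prop)
  have hpr' : ∀ h : ℝ, IsProbabilityMeasure (P.withDensity (g h)) := fun h => hmap h ▸ hpr h
  have h1 := Measure.pi_map_pi (μ := fun _ : ι => P) (f := fun i x => t i + x)
    (fun i => by fun_prop)
  simp_rw [hmap] at h1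
  rw [pi_withDensity (fun _ : ι => P) (f := fun i => g (t i)) fun i => hg _] at h1
  have hm : Measurable fun x : ι → ℝ => ∏ i, g (t i) (x i) :=
    Finset.measurable_prod _ fun i _ => (hg _).comp (measurable_pi_apply i)
  have h2 := lintegral_withDensity_eq_lintegral_mul (Measure.pi fun _ : ι => P) hm hF
  rw [← h1, lintegral_map hF (by fun_prop)] at h2
  exact h2

end ProductMeasures

/-! ### Independent Bernoulli selections -/

section BernoulliWeights

variable {ι : Type*} [Fintype ι]

/-- The probability of `b` under the product of Bernoulli laws with parameters `p i`. -/
def bernWeight (p : ι → ℝ) (b : ι → Bool) : ℝ := ∏ i, if b i then p i else 1 - p i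

variable {p : ι → ℝ}

lemma bernWeight_nonneg (hp0 : ∀ i, 0 ≤ p i) (hp1 : ∀ i, p i ≤ 1) (b : ι → Bool) :
    0 ≤ bernWeight p b :=
  Finset.prod_nonneg fun i _ => by
    split_ifs
    · exact hp0 i
    · exact sub_nonneg.2 (hp1 i)

variable [DecidableEq ι]

/-- Independence, as expansion of a product of two-term sums. The moments below come from factors `c
i` that are trivial except at one or two indices. -/
lemma sum_bernWeight_mul_prod (p : ι → ℝ) (c : ι → Bool → ℝ) :
    ∑ b, bernWeight p b * ∏ i, c i (b i) = ∏ i, (p i * c i true + (1 - p i) * c i false) := by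
  simp_rw [bernWeight, ← Finset.prod_mul_distrib]
  rw [← Fintype.prod_sum (fun i x => (if x = true then p i else 1 - p i) * c i x)]
  simp

lemma sum_bernWeight (p : ι → ℝ) : ∑ b, bernWeight p b = 1 := by
  simpa using sum_bernWeight_mul_prod p (fun _ _ => 1)

lemma sum_bernWeight_mul_ite (p : ι → ℝ) (j : ι) :
    ∑ b, bernWeight p b * (if b j then 1 else 0) = p j := by
  have h := sum_bernWeight_mul_prod p (fun k x => if k = j then (if x then 1 else 0) else 1)
  have e : ∀ k, (p k * (if k = j then (if true then (1 : ℝ) else 0) else 1) +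
      (1 - p k) * (if k = j then (if false then (1 : ℝ) else 0) else 1)) =
      if k = j then p k else 1 := fun k => by split_ifs <;> simp_all
  refine Eq.trans ?_ (h.trans ((Finset.prod_congr rfl fun k _ => e k).trans ?_))
  · simp only [Finset.prod_ite_eq', Finset.mem_univ, if_true]
  · simp only [Finset.prod_ite_eq', Finset.mem_univ, if_true]

lemma sum_bernWeight_mul_ite_mul_ite (p : ι → ℝ) {i j : ι} (hij : i ≠ j) :
    ∑ b, bernWeight p b * ((if b i then 1 else 0) * (if b j then 1 else 0)) = p i * p j := by
  have h := sum_bernWeight_mul_prod p (fun k x =>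
    (if k = i then (if x then 1 else 0) else 1) * (if k = j then (if x then 1 else 0) else 1))
  have e : ∀ k, (p k * ((if k = i then (if true then (1 : ℝ) else 0) else 1) *
      (if k = j then (if true then (1 : ℝ) else 0) else 1)) +
      (1 - p k) * ((if k = i then (if false then (1 : ℝ) else 0) else 1) *
      (if k = j then (if false then (1 : ℝ) else 0) else 1))) =
      (if k = i then p k else 1) * (if k = j then p k else 1) := fun k => by
    by_cases h1 : k = i
    · subst h1; simp [hij]
    · by_cases h2 : k = j
      · subst h2; simp [h1]
      · simp [h1, h2]
  refine Eq.trans ?_ (h.trans ((Finset.prod_congr rfl fun k _ => e k).trans ?_))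
  · simp only [Finset.prod_mul_distrib, Finset.prod_ite_eq', Finset.mem_univ, if_true]
  · simp only [Finset.prod_mul_distrib, Finset.prod_ite_eq', Finset.mem_univ, if_true]

/-- If the expected number of successes is at most `s / 2`, then restricting to at most `s`
successes loses at most half of the probability of each success. -/
lemma half_le_sum_bernWeight (hp0 : ∀ i, 0 ≤ p i) (hp1 : ∀ i, p i ≤ 1) {s : ℕ} (hs : 1 ≤ s)
    (hsum : ∑ i, p i ≤ s / 2) (j : ι) :
    p j / 2 ≤ ∑ b with (Finset.univ.filter fun i => b i = true).card ≤ s,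
      bernWeight p b * (if b j then 1 else 0) := by
  have hs0 : (0 : ℝ) < s := by exact_mod_cast hs
  -- If `j` succeeds among more than `s` successes, at least `s` others succeed, so the lost
  -- indicator is at most `∑_{i≠j} 1_i 1_j / s`, of mean at most `(s/2) p_j / s`.
  have pt : ∀ b : ι → Bool,
      bernWeight p b * (if b j then 1 else 0) - (∑ i ∈ Finset.univ.erase j,
        bernWeight p b * ((if b i then 1 else 0) * (if b j then 1 else 0))) / s ≤
      if (Finset.univ.filter fun i => b i = true).card ≤ s then
        bernWeight p b * (if b j then 1 else 0) else 0 := fun b => by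
    have hw := bernWeight_nonneg hp0 hp1 b
    have hnn : 0 ≤ (∑ i ∈ Finset.univ.erase j,
        bernWeight p b * ((if b i then (1 : ℝ) else 0) * (if b j then 1 else 0))) / s := by
      refine div_nonneg (Finset.sum_nonneg fun i _ => ?_) hs0.le
      split_ifs <;> simp [hw]
    by_cases hN : (Finset.univ.filter fun i => b i = true).card ≤ s
    · rw [if_pos hN]; linarith
    · rw [if_neg hN]
      rw [not_le] at hN
      by_cases hj : b j = true
      · have hcard : ∑ i ∈ Finset.univ.erase j, (if b i then (1 : ℝ) else 0) =
            (Finset.univ.filter fun i => b i = true).card - 1 := by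
          have := Finset.add_sum_erase Finset.univ (fun i => if b i then (1 : ℝ) else 0)
            (Finset.mem_univ j)
          have h2 : ∑ i, (if b i then (1 : ℝ) else 0) =
            (Finset.univ.filter fun i => b i = true).card := Finset.sum_boole _ _
          simp only [hj, if_true, h2] at this
          linarith
        have hN' : (s : ℝ) + 1 ≤ (Finset.univ.filter fun i => b i = true).card := by
          exact_mod_cast hN
        simp only [hj, if_true, mul_one]
        rw [← Finset.mul_sum, hcard, sub_nonpos, le_div_iff₀ hs0]
        exact mul_le_mul_of_nonneg_left (by linarith) hw
      · simp [hj]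
  have h := Finset.sum_le_sum fun b (_ : b ∈ Finset.univ) => pt b
  rw [Finset.sum_filter]
  refine le_trans ?_ h
  rw [Finset.sum_sub_distrib, sum_bernWeight_mul_ite, ← Finset.sum_div, Finset.sum_comm,
    Finset.sum_congr rfl fun i hi => sum_bernWeight_mul_ite_mul_ite p (Finset.ne_of_mem_erase hi),
    ← Finset.sum_mul]
  have h1 : ∑ i ∈ Finset.univ.erase j, p i ≤ s / 2 :=
    (Finset.sum_le_sum_of_subset_of_nonneg (Finset.erase_subset _ _) fun i _ _ => hp0 i).trans hsum
  have h2 : (∑ i ∈ Finset.univ.erase j, p i) * p j / s ≤ p j / 2 := by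
    rw [div_le_iff₀ hs0]
    nlinarith [mul_le_mul_of_nonneg_right h1 (hp0 j)]
  linarith

end BernoulliWeights

/-! ### Testing zero against a sparse mixture -/

section Mixture

/-- The cross terms sum to `1 - p²`, leaving at most `1 + p²M`. The exponential form turns the
product over coordinates into a sum. -/
lemma lintegral_mixture_sq_le {P : Measure ℝ} [IsProbabilityMeasure P] {g : ℝ → ℝ≥0∞}
    (hg : Measurable g) (hg1 : ∫⁻ x, g x ∂P = 1) {p M : ℝ} (hp0 : 0 ≤ p) (hp1 : p ≤ 1)
    (hM0 : 0 ≤ M) (hM : ∫⁻ x, g x ^ 2 ∂P ≤ ENNReal.ofReal M) :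
    ∫⁻ x, (ENNReal.ofReal p * g x + ENNReal.ofReal (1 - p)) ^ 2 ∂P ≤
      ENNReal.ofReal (Real.exp (p ^ 2 * M)) := by
  have e : ∀ x, (ENNReal.ofReal p * g x + ENNReal.ofReal (1 - p)) ^ 2 =
      ENNReal.ofReal p ^ 2 * g x ^ 2 + (2 * ENNReal.ofReal p * ENNReal.ofReal (1 - p)) * g x +
        ENNReal.ofReal (1 - p) ^ 2 := fun x => by ring
  simp_rw [e]
  rw [lintegral_add_right _ measurable_const, lintegral_add_right _ (by fun_prop),
    lintegral_const_mul _ (by fun_prop), lintegral_const_mul _ hg, hg1, lintegral_const,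
    measure_univ, mul_one, mul_one]
  calc ENNReal.ofReal p ^ 2 * ∫⁻ x, g x ^ 2 ∂P + 2 * ENNReal.ofReal p * ENNReal.ofReal (1 - p) +
        ENNReal.ofReal (1 - p) ^ 2
      ≤ ENNReal.ofReal p ^ 2 * ENNReal.ofReal M + 2 * ENNReal.ofReal p * ENNReal.ofReal (1 - p) +
        ENNReal.ofReal (1 - p) ^ 2 := by gcongr
    _ = ENNReal.ofReal (p ^ 2 * M + 2 * p * (1 - p) + (1 - p) ^ 2) := by
      have hq : 0 ≤ 1 - p := by linarith
      rw [ENNReal.ofReal_add (by positivity) (by positivity),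
        ENNReal.ofReal_add (by positivity) (by positivity), ENNReal.ofReal_mul (by positivity),
        ENNReal.ofReal_mul (by positivity), ENNReal.ofReal_mul (by positivity),
        ENNReal.ofReal_pow hp0, ENNReal.ofReal_pow hq]
      norm_num
    _ ≤ ENNReal.ofReal (Real.exp (p ^ 2 * M)) := by
      refine ENNReal.ofReal_le_ofReal ?_
      have := Real.add_one_le_exp (p ^ 2 * M)
      nlinarith [sq_nonneg p]

variable {d : ℕ}

/-- For a product prior the mixture likelihood ratio factorizes, so its second moment can be
computed by coordinates. -/
lemma sum_ofReal_bernWeight_mul_prod {p : Fin d → ℝ} (hp0 : ∀ i, 0 ≤ p i) (hp1 : ∀ i, p i ≤ 1)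
    {g : ℝ → ℝ → ℝ≥0∞} (hg0 : ∀ x, g 0 x = 1) (h x : Fin d → ℝ) :
    ∑ b, ENNReal.ofReal (bernWeight p b) * ∏ i, g (if b i then h i else 0) (x i) =
      ∏ i, (ENNReal.ofReal (p i) * g (h i) (x i) + ENNReal.ofReal (1 - p i)) := by
  have e : ∀ b : Fin d → Bool, ENNReal.ofReal (bernWeight p b) *
      ∏ i, g (if b i then h i else 0) (x i) =
      ∏ i, (ENNReal.ofReal (if b i then p i else 1 - p i) * g (if b i then h i else 0) (x i)) :=
    fun b => by
      rw [Finset.prod_mul_distrib, bernWeight, ENNReal.ofReal_prod_of_nonneg]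
      intro i _
      split_ifs
      · exact hp0 i
      · exact sub_nonneg.2 (hp1 i)
  simp_rw [e]
  rw [← Fintype.prod_sum (fun i y => ENNReal.ofReal (if y = true then p i else 1 - p i) *
    g (if y = true then h i else 0) (x i))]
  simp [hg0]

variable {α τ σ : ℝ} {η : Fin d → ℝ} {s : ℕ}

/-- The method of two hypotheses, the signal `0` against the mixture over the signals with
independent coordinates `σ h_j` with probability `p_j` and `0` otherwise. -/
theorem le_maxRisk_of_prior {P : Measure ℝ} (hP : SymmSubWeibull α τ P) {g : ℝ → ℝ → ℝ≥0∞}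
    (hg : ∀ h, Measurable (g h)) (hg0 : ∀ x, g 0 x = 1)
    (hmap : ∀ h, P.map (fun x => h + x) = P.withDensity (g h))
    (hs : 1 ≤ s) (hσ : 0 < σ) {p h M : Fin d → ℝ} (hp0 : ∀ i, 0 ≤ p i) (hp1 : ∀ i, p i ≤ 1)
    (hsum : ∑ i, p i ≤ s / 2) (hv : ∀ i, 0 ≤ η i * h i) (hM0 : ∀ i, 0 ≤ M i)
    (hM : ∀ i, ∫⁻ x, g (h i) x ^ 2 ∂P ≤ ENNReal.ofReal (M i))
    {T : (Fin d → ℝ) → ℝ} (hT : Measurable T) :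
    ENNReal.ofReal ((σ * (∑ i, p i * (η i * h i)) / 2 /
      (Real.exp ((∑ i, p i ^ 2 * M i) / 2) + 1)) ^ 2) ≤ maxRisk α τ σ η s T := by
  have hprob := hP.isProb
  set μ := Measure.pi fun _ : Fin d => P with hμ
  set R := maxRisk α τ σ η s T with hR
  set ρ := R ^ (1 / 2 : ℝ) with hρ
  have hρR : ρ ^ 2 = R := by
    rw [hρ, ← ENNReal.rpow_natCast, ← ENNReal.rpow_mul]; norm_num
  set k := Real.exp ((∑ i, p i ^ 2 * M i) / 2) with hk
  have hk0 : 0 < k := Real.exp_pos _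
  set S : (Fin d → ℝ) → ℝ := fun x => T (fun i => σ * x i) with hS
  have hSm : Measurable S := hT.comp (by fun_prop)
  set t : (Fin d → Bool) → Fin d → ℝ := fun b i => if b i then h i else 0 with ht
  have sq_mono := ENNReal.pow_right_strictMono (n := 2) two_ne_zero
  have hSabs : Measurable fun x => ENNReal.ofReal |S x| :=
    (continuous_abs.measurable.comp hSm).ennreal_ofReal
  have hSt : ∀ b, Measurable fun ξ : Fin d → ℝ => S (fun i => t b i + ξ i) := fun b =>
    hSm.comp (measurable_pi_lambda _ fun i => (measurable_pi_apply i).const_add _)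
  have hStabs : ∀ b c, Measurable fun ξ : Fin d → ℝ =>
      ENNReal.ofReal |S (fun i => t b i + ξ i) - c| := fun b c =>
    (continuous_abs.measurable.comp ((hSt b).sub_const c)).ennreal_ofReal
  have risk : ∀ b : Fin d → Bool, (Finset.univ.filter fun i => b i = true).card ≤ s →
      ∫⁻ ξ, ENNReal.ofReal |S (fun i => t b i + ξ i) - σ * linFun η (t b)| ∂μ ≤ ρ := by
    intro b hb
    refine sq_mono.le_iff_le.1 ?_
    simp only [hρR]
    have hmem : (fun i => σ * t b i) ∈ sparseSet d s := by
      show zeroNorm _ ≤ s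
      refine le_trans ?_ hb
      rw [zeroNorm, ← Set.ncard_coe_finset]
      refine Set.ncard_le_ncard (fun i hi => ?_) (Set.toFinite _)
      simp only [Finset.coe_filter, Finset.mem_univ, true_and, Set.mem_ofPred_eq]
      by_contra hbi
      exact hi (by simp [ht, hbi])
    have h1 : mse σ η T (fun i => σ * t b i) (fun _ => P) ≤ R :=
      (le_iSup₂_of_le (f := fun P (_ : P ∈ noiseClass d α τ) =>
        mse σ η T (fun i => σ * t b i) P) (fun _ => P) (fun _ => hP) le_rfl).trans
        (le_iSup₂ (f := fun θ (_ : θ ∈ sparseSet d s) =>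
          ⨆ P ∈ noiseClass d α τ, mse σ η T θ P) _ hmem)
    refine le_trans ?_ h1
    rw [mse_eq hT]
    have hcs := sq_lintegral_mul_le μ
      (f := fun ξ => ENNReal.ofReal |S (fun i => t b i + ξ i) - σ * linFun η (t b)|)
      (g := fun _ => 1) (hStabs b _).aemeasurable aemeasurable_const
    simp only [mul_one, one_pow, lintegral_const, measure_univ] at hcs
    refine hcs.trans_eq (lintegral_congr fun ξ => ?_)
    rw [← ENNReal.ofReal_pow (abs_nonneg _), sq_abs]
    simp only [hS, mul_add, linFun, Finset.mul_sum, mul_left_comm]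
  have null : ∫⁻ x, ENNReal.ofReal |S x| ^ 2 ∂μ ≤ R := by
    have hmem : (fun _ => 0 : Fin d → ℝ) ∈ sparseSet d s := by
      show zeroNorm _ ≤ s
      simp [zeroNorm]
    have h1 : mse σ η T (fun _ => 0) (fun _ => P) ≤ R :=
      (le_iSup₂_of_le (f := fun P (_ : P ∈ noiseClass d α τ) =>
        mse σ η T (fun _ => 0) P) (fun _ => P) (fun _ => hP) le_rfl).trans
        (le_iSup₂ (f := fun θ (_ : θ ∈ sparseSet d s) =>
          ⨆ P ∈ noiseClass d α τ, mse σ η T θ P) _ hmem)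
    refine le_trans (le_of_eq ?_) h1
    rw [mse_eq hT]
    refine lintegral_congr fun ξ => ?_
    rw [← ENNReal.ofReal_pow (abs_nonneg _), sq_abs]
    simp [hS, linFun]
  have hgh : ∀ i, ∫⁻ x, g (h i) x ∂P = 1 := fun i => by
    have := Measure.isProbabilityMeasure_map (μ := P) (f := fun x => h i + x) (by fun_prop)
    have h1 : P.map (fun x => h i + x) Set.univ = 1 := measure_univ
    rwa [hmap, withDensity_apply _ MeasurableSet.univ, setLIntegral_univ] at h1
  -- Change of measure to the null law and Cauchy–Schwarz: the null risk contributes `ρ`, the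
  -- mixture likelihood ratio contributes `k`.
  have mix : ∑ b, ENNReal.ofReal (bernWeight p b) *
      ∫⁻ ξ, ENNReal.ofReal |S (fun i => t b i + ξ i)| ∂μ ≤ ρ * ENNReal.ofReal k := by
    have e1 : ∑ b, ENNReal.ofReal (bernWeight p b) *
        ∫⁻ ξ, ENNReal.ofReal |S (fun i => t b i + ξ i)| ∂μ =
        ∫⁻ x, ENNReal.ofReal |S x| * ∏ i, (ENNReal.ofReal (p i) * g (h i) (x i) +
          ENNReal.ofReal (1 - p i)) ∂μ := by
      have hG : ∀ b, Measurable fun x : Fin d → ℝ => ∏ i, g (t b i) (x i) := fun b =>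
        Finset.measurable_prod _ fun i _ => (hg _).comp (measurable_pi_apply i)
      have hGS : ∀ b, Measurable fun x : Fin d → ℝ =>
          (∏ i, g (t b i) (x i)) * ENNReal.ofReal |S x| := fun b => (hG b).mul hSabs
      have e2 : ∀ b, ENNReal.ofReal (bernWeight p b) *
          ∫⁻ ξ, ENNReal.ofReal |S (fun i => t b i + ξ i)| ∂μ =
          ∫⁻ x, ENNReal.ofReal (bernWeight p b) *
            ((∏ i, g (t b i) (x i)) * ENNReal.ofReal |S x|) ∂μ := fun b => by
        rw [lintegral_const_mul _ (hGS b), hμ,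
          lintegral_translate_pi hg hmap (t b) (F := fun x => ENNReal.ofReal |S x|) hSabs]
      simp_rw [e2]
      rw [← lintegral_finsetSum _ fun b _ => (hGS b).const_mul _]
      refine lintegral_congr fun x => ?_
      rw [← sum_ofReal_bernWeight_mul_prod hp0 hp1 hg0, Finset.mul_sum]
      refine Finset.sum_congr rfl fun b _ => ?_
      ring
    rw [e1]
    refine sq_mono.le_iff_le.1 ?_
    have hfm : Measurable fun x : Fin d → ℝ => ∏ i, (ENNReal.ofReal (p i) * g (h i) (x i) +
        ENNReal.ofReal (1 - p i)) :=
      Finset.measurable_prod _ fun i _ =>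
        (((hg _).comp (measurable_pi_apply i)).const_mul _).add_const _
    refine (sq_lintegral_mul_le μ hSabs.aemeasurable hfm.aemeasurable).trans ?_
    simp only [mul_pow, hρR]
    refine mul_le_mul' null ?_
    simp_rw [← Finset.prod_pow]
    rw [hμ, lintegral_prod_pi (fun _ : Fin d => P) (f := fun i y =>
      (ENNReal.ofReal (p i) * g (h i) y + ENNReal.ofReal (1 - p i)) ^ 2)
      fun i => (((hg _).const_mul _).add_const _).pow_const 2]
    refine (Finset.prod_le_prod' fun i _ =>
      lintegral_mixture_sq_le (hg _) (hgh i) (hp0 i) (hp1 i) (hM0 i) (hM i)).trans_eq ?_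
    rw [← ENNReal.ofReal_prod_of_nonneg fun i _ => (Real.exp_pos _).le, ← Real.exp_sum,
      ← ENNReal.ofReal_pow hk0.le, hk, ← Real.exp_nat_mul]
    congr 2
    push_cast
    ring
  have hL : ∀ b, linFun η (t b) = ∑ i, η i * h i * (if b i then 1 else 0) := fun b =>
    Finset.sum_congr rfl fun i _ => by simp [ht]
  have hLnn : ∀ b, 0 ≤ linFun η (t b) := fun b => by
    rw [hL]
    exact Finset.sum_nonneg fun i _ => mul_nonneg (hv i) (by split_ifs <;> norm_num)
  have key : ∀ b : Fin d → Bool, (Finset.univ.filter fun i => b i = true).card ≤ s →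
      ENNReal.ofReal (σ * linFun η (t b)) ≤
        ∫⁻ ξ, ENNReal.ofReal |S (fun i => t b i + ξ i)| ∂μ + ρ := by
    intro b hb
    refine le_trans ?_ (add_le_add_right (risk b hb) _)
    rw [← lintegral_add_right _ (hStabs b _)]
    calc ENNReal.ofReal (σ * linFun η (t b)) = ∫⁻ _, ENNReal.ofReal (σ * linFun η (t b)) ∂μ := by
          simp
      _ ≤ _ := by
        refine lintegral_mono fun ξ => ?_
        rw [← ENNReal.ofReal_add (abs_nonneg _) (abs_nonneg _)]
        refine ENNReal.ofReal_le_ofReal ?_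
        have h1 := le_abs_self (S fun i => t b i + ξ i)
        have h2 := neg_abs_le (S (fun i => t b i + ξ i) - σ * linFun η (t b))
        linarith
  have lower : σ * (∑ i, p i * (η i * h i)) / 2 ≤
      ∑ b with (Finset.univ.filter fun i => b i = true).card ≤ s,
        bernWeight p b * (σ * linFun η (t b)) := by
    have e : ∑ b with (Finset.univ.filter fun i => b i = true).card ≤ s,
        bernWeight p b * (σ * linFun η (t b)) = σ * ∑ i, η i * h i *
          ∑ b with (Finset.univ.filter fun i => b i = true).card ≤ s,
            bernWeight p b * (if b i then 1 else 0) := by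
      simp only [Finset.mul_sum, hL]
      rw [Finset.sum_comm]
      refine Finset.sum_congr rfl fun i _ => Finset.sum_congr rfl fun b _ => ?_
      ring
    rw [e, mul_div_assoc, Finset.sum_div]
    refine mul_le_mul_of_nonneg_left (Finset.sum_le_sum fun i _ => ?_) hσ.le
    have := mul_le_mul_of_nonneg_left (half_le_sum_bernWeight hp0 hp1 hs hsum i) (hv i)
    linarith
  have total : ENNReal.ofReal (σ * (∑ i, p i * (η i * h i)) / 2) ≤
      ρ * ENNReal.ofReal (k + 1) := by
    calc ENNReal.ofReal (σ * (∑ i, p i * (η i * h i)) / 2)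
        ≤ ENNReal.ofReal (∑ b with (Finset.univ.filter fun i => b i = true).card ≤ s,
          bernWeight p b * (σ * linFun η (t b))) := ENNReal.ofReal_le_ofReal lower
      _ = ∑ b with (Finset.univ.filter fun i => b i = true).card ≤ s,
          ENNReal.ofReal (bernWeight p b) * ENNReal.ofReal (σ * linFun η (t b)) := by
        rw [ENNReal.ofReal_sum_of_nonneg fun b _ =>
          mul_nonneg (bernWeight_nonneg hp0 hp1 b) (mul_nonneg hσ.le (hLnn b))]
        exact Finset.sum_congr rfl fun b _ => ENNReal.ofReal_mul (bernWeight_nonneg hp0 hp1 b)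
      _ ≤ ∑ b with (Finset.univ.filter fun i => b i = true).card ≤ s,
          ENNReal.ofReal (bernWeight p b) *
            (∫⁻ ξ, ENNReal.ofReal |S (fun i => t b i + ξ i)| ∂μ + ρ) :=
        Finset.sum_le_sum fun b hb => mul_le_mul_right (key b (Finset.mem_filter.1 hb).2) _
      -- Dense `b` only add nonnegative terms here, so no risk bound is needed outside the sparse
      -- set.
      _ ≤ ∑ b, ENNReal.ofReal (bernWeight p b) *
            (∫⁻ ξ, ENNReal.ofReal |S (fun i => t b i + ξ i)| ∂μ + ρ) :=
        Finset.sum_le_sum_of_subset (Finset.filter_subset _ _)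
      _ = ∑ b, ENNReal.ofReal (bernWeight p b) *
            ∫⁻ ξ, ENNReal.ofReal |S (fun i => t b i + ξ i)| ∂μ + ρ := by
        simp_rw [mul_add]
        rw [Finset.sum_add_distrib, ← Finset.sum_mul,
          ← ENNReal.ofReal_sum_of_nonneg fun b _ => bernWeight_nonneg hp0 hp1 b, sum_bernWeight,
          ENNReal.ofReal_one, one_mul]
      _ ≤ ρ * ENNReal.ofReal k + ρ := add_le_add_left mix _
      _ = ρ * ENNReal.ofReal (k + 1) := by
        rw [ENNReal.ofReal_add hk0.le zero_le_one, ENNReal.ofReal_one, mul_add, mul_one]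
  have hk1 : 0 < k + 1 := by linarith
  have hfin : ENNReal.ofReal (σ * (∑ i, p i * (η i * h i)) / 2 / (k + 1)) ≤ ρ := by
    rw [ENNReal.ofReal_div_of_pos hk1]
    exact ENNReal.div_le_of_le_mul total
  rw [ENNReal.ofReal_pow, ← hρR]
  · exact pow_le_pow_left₀ zero_le hfin 2
  · have : 0 ≤ ∑ i, p i * (η i * h i) := Finset.sum_nonneg fun i _ => mul_nonneg (hp0 i) (hv i)
    positivity

end Mixture

/-! ### Choice of the prior and the minimax bound -/

section LowerBound

theorem exists_le_minimaxRisk {α : ℝ} (hα : 0 < α) : ∃ c τα : ℝ, 0 < c ∧ 0 < τα ∧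
    ∀ τ : ℝ, τα ≤ τ → ∀ (d : ℕ) (η : Fin d → ℝ), (∀ j, η j ≠ 0) →
      ∀ s : ℕ, 1 ≤ s → s ≤ d → ∀ σ : ℝ, 0 < σ →
        ENNReal.ofReal (c * σ ^ 2 * phiO α η s) ≤ minimaxRisk α τ σ η s := by
  obtain ⟨P, g, τα, κ, K, hτα, hκ, hK, hP, hg, hg0, hmap, hchi⟩ := exists_noise hα
  -- The `4` combines the factor 2 lost to sparsity with `ls/2 + ν ≥ (ls + ν)/2`.
  refine ⟨(κ / 4 / (Real.exp (K / 2) + 1)) ^ 2, τα, by positivity, hτα,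
    fun τ hτ d η hη s hs hsd σ hσ => le_iInf₂ fun T hT => ?_⟩
  have hd : 0 < d := by omega
  set l := lambdaO α η s with hl
  have hl0 : 0 ≤ l := lambdaO_nonneg s
  set ν := nu α η s with hν
  have hν0 : 0 < ν := nu_pos hα hd hη s
  have ha : ∀ j, 0 < |η j| := fun j => abs_pos.2 (hη j)
  set e : Fin d → ℝ := fun j => Real.exp (-(l / |η j|) ^ α) with he
  have he0 : ∀ j, 0 < e j := fun j => Real.exp_pos _
  have he1 : ∀ j, e j ≤ 1 := fun j => Real.exp_le_one_iff.2 (by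
    rw [neg_nonpos]; exact Real.rpow_nonneg (by positivity) _)
  have hν2 : ν ^ 2 = ∑ j, η j ^ 2 * e j := nu_sq s
  have hp1 : ∀ j, |η j| * e j / ν ≤ 1 := fun j => by
    rw [div_le_one hν0]
    refine le_of_sq_le_sq ?_ hν0.le
    rw [hν2]
    refine le_trans ?_ (Finset.single_le_sum (f := fun j => η j ^ 2 * e j)
      (fun i _ => mul_nonneg (sq_nonneg _) (he0 i).le) (Finset.mem_univ j))
    rw [mul_pow, sq_abs]
    exact mul_le_mul_of_nonneg_left (by nlinarith [he0 j, he1 j]) (sq_nonneg _)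
  have hv : ∀ j, η j * (SignType.sign (η j) * (κ * (l / |η j| + 1))) = κ * (l + |η j|) := by
    intro j
    rw [← mul_assoc, self_mul_sign]
    have := (ha j).ne'
    field_simp
  have habs : ∀ j, |((SignType.sign (η j) : SignType) : ℝ) * (κ * (l / |η j| + 1))| ≤
      κ * (l / |η j| + 1) := fun j => by
    have h0 : 0 ≤ κ * (l / |η j| + 1) := by positivity
    rw [abs_mul, abs_of_nonneg h0]
    refine mul_le_of_le_one_left h0 ?_
    rcases lt_or_gt_of_ne (hη j) with h | h <;> simp [h]
  have main := le_maxRisk_of_prior (hP τ hτ) hg hg0 hmap hs hσ (η := η)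
    (p := fun j => |η j| * e j / ν)
    (h := fun j => SignType.sign (η j) * (κ * (l / |η j| + 1)))
    (M := fun j => K * Real.exp ((l / |η j|) ^ α))
    (fun j => div_nonneg (mul_nonneg (ha j).le (he0 j).le) hν0.le) hp1
    (by
      rw [← Finset.sum_div, div_le_iff₀ hν0]
      exact sum_abs_mul_exp_le hα hη hs hsd)
    (fun j => by rw [hv]; have := ha j; positivity)
    (fun j => mul_nonneg hK (Real.exp_pos _).le)
    (fun j => hchi _ _ (by positivity) (habs j)) hT
  refine le_trans (ENNReal.ofReal_le_ofReal ?_) main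
  -- One factor `e_j` of `p_j²` cancels the growth of the likelihood moment; what remains sums to
  -- `ν²`.
  have hchi2 : ∑ j, (|η j| * e j / ν) ^ 2 * (K * Real.exp ((l / |η j|) ^ α)) = K := by
    have h1 : ∀ j, (|η j| * e j / ν) ^ 2 * (K * Real.exp ((l / |η j|) ^ α)) =
        K / ν ^ 2 * (η j ^ 2 * e j) := fun j => by
      have : e j * Real.exp ((l / |η j|) ^ α) = 1 := by
        rw [he, ← Real.exp_add, neg_add_cancel, Real.exp_zero]
      rw [div_pow, mul_pow, sq_abs]
      calc η j ^ 2 * e j ^ 2 / ν ^ 2 * (K * Real.exp ((l / |η j|) ^ α))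
          = K / ν ^ 2 * (η j ^ 2 * e j) * (e j * Real.exp ((l / |η j|) ^ α)) := by ring
        _ = _ := by rw [this, mul_one]
    simp_rw [h1]
    rw [← Finset.mul_sum, ← hν2]
    field_simp
  have hmean : ∑ j, |η j| * e j / ν * (η j * (SignType.sign (η j) * (κ * (l / |η j| + 1)))) =
      κ * (l * s / 2 + ν) := by
    have h1 : ∀ j, |η j| * e j / ν * (η j * (SignType.sign (η j) * (κ * (l / |η j| + 1)))) =
        κ / ν * (l * (|η j| * e j) + η j ^ 2 * e j) := fun j => by
      rw [hv, ← sq_abs (η j)]; ring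
    simp_rw [h1]
    rw [← Finset.mul_sum, Finset.sum_add_distrib, ← hν2, ← Finset.mul_sum,
      lambdaO_mul_sum_abs_mul_exp hα hη hs hsd, ← hl, ← hν]
    field_simp
  rw [hchi2, hmean, phiO, ← mul_pow, ← mul_pow]
  have hls : 0 ≤ l * s := by positivity
  refine pow_le_pow_left₀ (by positivity) ?_ 2
  rw [div_mul_eq_mul_div, div_mul_eq_mul_div]
  refine div_le_div_of_nonneg_right ?_ (by positivity)
  have : 0 ≤ σ * κ * ν := by positivity
  nlinarith

end LowerBound

end SparseFunctional

end

theorem mainTheorem1 (α : ℝ) (hα : 0 < α) :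
    (∀ (d : ℕ) (η : Fin d → ℝ), (∀ j, η j ≠ 0) → Antitone (fun j => |η j|) →
      ∀ s : ℕ, 1 ≤ s → s ≤ d → ∃! β : ℝ, SparseFunctional.BetaEquation α η s β) ∧
    (∃ c τα : ℝ, 0 < c ∧ 0 < τα ∧
      ∀ τ : ℝ, τα ≤ τ →
      ∀ (d : ℕ) (η : Fin d → ℝ), (∀ j, η j ≠ 0) → Antitone (fun j => |η j|) →
      ∀ s : ℕ, 1 ≤ s → s ≤ d → ∀ σ : ℝ, 0 < σ →
        ENNReal.ofReal (c * σ ^ 2 * SparseFunctional.phiO α η s) ≤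
          SparseFunctional.minimaxRisk α τ σ η s) ∧
    (∀ τ : ℝ, 0 < τ → ∃ C : ℝ, 0 < C ∧
      ∀ (d : ℕ) (η : Fin d → ℝ), (∀ j, η j ≠ 0) → Antitone (fun j => |η j|) →
      ∀ s : ℕ, 1 ≤ s → s ≤ d → ∀ σ : ℝ, 0 < σ →
        Measurable (SparseFunctional.estimator α τ σ η s) ∧
        SparseFunctional.maxRisk α τ σ η s (SparseFunctional.estimator α τ σ η s) ≤
          ENNReal.ofReal (C * σ ^ 2 * SparseFunctional.phiO α η s)) := by
  refine ⟨fun d η hη _ s hs hsd =>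
    SparseFunctional.existsUnique_betaEquation hα hη hs hsd, ?_, fun τ hτ => ?_⟩
  · obtain ⟨c, τα, hc, hτα, h⟩ := SparseFunctional.exists_le_minimaxRisk hα
    exact ⟨c, τα, hc, hτα, fun τ hτ d η hη _ => h τ hτ d η hη⟩
  · obtain ⟨C, hC, h⟩ := SparseFunctional.exists_maxRisk_estimator_le hα hτ
    exact ⟨C, hC, fun d η hη hanti s _ _ σ hσ =>
      ⟨SparseFunctional.measurable_estimator, h d η hη hanti s σ hσ⟩⟩
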